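/- For real $\kappa$ let $d_\kappa$ be the multiplicative function with $d_\kappa(p^j)=\binom{\kappa+j-1}{j}$ (the usual $\kappa$-fold divisor function when $\kappa$ is a positive integer), let $\Omega(m)$ be the number of prime factors of $m$ counted with multiplicity, and let $e(t)=e^{2\pi i t}$. Fix a real number $k\ge 2$ and $0<\varepsilon'<1$. For $X\ge 3$ put $M=X^{2k/\log\log X}$ and $$\tilde d_k(n)=1_{(X,2X]}(n)\sum_{\substack{m\mid n,\ m\le M\\ \Omega(m)\le(1+\varepsilon')k\log\log X}}d_{k-1}(m).$$ Proposition. There are a constant $C>0$ and a function $\delta:\mathbb R\to\mathbb R$ with $\delta(X)\to0$ as $X\to\infty$, both depending only on $k$ and $\varepsilon'$, such that the following holds. Let $X\ge3$ and $X\ge H_1\ge(\log X)^{20k\log k}$, and let $$Q_1\le\min\{H_1^{1/3}/(\log X)^{k\log k},\ (\log X)^{10000k^{10}}\}.$$ Let $\alpha\in\mathbb T=\mathbb R/\mathbb Z$ satisfy $\|\alpha-\frac aq\|_{\mathbb T}<\frac1{qQ_1}$ for some integers $a$ and $1\le q\le Q_1$ with $(a,q)=1$, where $\|\cdot\|_{\mathbb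 T}$ is the distance to the nearest integer. Then there is a measurable exceptional set $\mathcal E\subset[X/2,2X]$ (possibly depending on $\alpha$ and the other parameters) of Lebesgue measure $$m(\mathcal E)\le C\,\frac{X(\log X)^{3k\log k}}{Q_1^{1/8}}$$ such that for all $x\in[X/2,2X]\setminus\mathcal E$, $$\sup_{0\le H'\le H_1}\Bigl|\sum_{x\le n\le x+H'}\tilde d_k(n)e(\alpha n)\Bigr|\le C\Bigl(\frac1q+\frac1{Q_1^{1/8}}\Bigr)H_1(\log X)^{k-1+\delta(X)}.$$ -/

import Mathlib

open Filter Topology MeasureTheory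

noncomputable section

/-- The `κ`-th divisor function `d_κ` for a real number `κ`: the multiplicative function with
`d_κ(p^j) = binom(κ + j - 1, j) = κ (κ + 1) ⋯ (κ + j - 1) / j!`. For `κ = 1, 2, 3, …` it counts
the factorizations `n = n₁ ⋯ n_κ` into positive integers. (Only evaluated at `n ≥ 1`.) -/
def divisorFn (κ : ℝ) (n : ℕ) : ℝ :=
  n.factorization.prod fun _ j => ∏ i ∈ Finset.range j, (κ + i) / (i + 1)

/-- The level `M = X ^ (2 k / log log X)`. -/
def levelM (k X : ℝ) : ℝ := X ^ (2 * k / Real.log (Real.log X))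

open Classical in
/-- The truncated divisor function `d̃_k(n) = 1_{(X,2X]}(n) ∑ d_{k-1}(m)`, where the sum is over
`m ∣ n` with `m ≤ M` and `Ω(m) ≤ (1 + ε') k log log X`. It depends on `ε'`, `k` and `X`. -/
def divisorTilde (ε' k X : ℝ) (n : ℕ) : ℝ :=
  if X < n ∧ (n : ℝ) ≤ 2 * X then
    ∑ m ∈ n.divisors.filter (fun m : ℕ => (m : ℝ) ≤ levelM k X ∧
        (ArithmeticFunction.cardFactors m : ℝ) ≤ (1 + ε') * k * Real.log (Real.log X)),
      divisorFn (k - 1) m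
  else 0

end

/-! Write `α = a/q + β` with `|β| < 1/(q * Q₁)`, `z = e(a/q)`, `Z = Q₁ ^ (1/8)`, and cut the
interval into blocks of length `B ≈ q * Z ^ 7`. On a block `e(βn)` moves by only `O(1/Z)`, so only
the twist `z ^ n` matters.

Open the divisor sum over the moduli `m`. If `q ∣ m`, then `z ^ n = 1` on all multiples of `m`;
submultiplicativity bounds the total weight of these moduli by `d(q)/q` times the full mean. This is
the `1/q` term. If `q ∤ m`, then `z ^ m ≠ 1` and there should be cancellation. In the second moment
over starting points `y`, a pair `(m₁, m₂)` with gcd `g` forces the two offsets to agree mod `g`;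
the inner sum is then geometric with ratio a conjugate of `z ^ g ≠ 1`, hence at most `q`
(`norm_sum_multExpSum_mul_conj_le`). The untwisted counts have a comparable variance
(`sum_multCount_sub_mul_le`). Both reduce to `∑ w(m₁) w(m₂) / lcm(m₁, m₂)`, a power of `log X`.

Cauchy–Schwarz, a sum over the blocks and Markov's inequality give the exceptional set
(`exists_exceptional_set`). The block errors are added in absolute value, so one set serves every
`H'`. The mean is `O((log X) ^ (k-1))` by Rankin's trick, and `d(q) = (log X) ^ o(1)` since `q` is
at most a fixed power of `log X`; this factor is the source of `δ`. -/

/-! ### The divisor function: local factors and submultiplicativity. -/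

/-- The value of `divisorFn κ` at the `j`-th power of a prime. -/
noncomputable def divisorCoeff (κ : ℝ) (j : ℕ) : ℝ := ∏ i ∈ Finset.range j, (κ + i) / (i + 1)

@[simp] lemma divisorCoeff_zero (κ : ℝ) : divisorCoeff κ 0 = 1 := by simp [divisorCoeff]

lemma divisorCoeff_succ (κ : ℝ) (j : ℕ) :
    divisorCoeff κ (j + 1) = divisorCoeff κ j * ((κ + j) / (j + 1)) := by
  rw [divisorCoeff, Finset.prod_range_succ, ← divisorCoeff]

lemma one_le_divisorCoeff {κ : ℝ} (hκ : 1 ≤ κ) (j : ℕ) : 1 ≤ divisorCoeff κ j := by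
  induction j with
  | zero => simp
  | succ j ih =>
    rw [divisorCoeff_succ]
    refine one_le_mul_of_one_le_of_one_le ih ?_
    rw [one_le_div (by positivity)]
    linarith

lemma divisorCoeff_le_pow {κ : ℝ} (hκ : 1 ≤ κ) (j : ℕ) : divisorCoeff κ j ≤ κ ^ j := by
  unfold divisorCoeff
  calc _ ≤ ∏ _i ∈ Finset.range j, κ := by
        refine Finset.prod_le_prod (fun i _ => by positivity) fun i _ => ?_
        rw [div_le_iff₀ (by positivity)]
        have : (0 : ℝ) ≤ i := i.cast_nonneg
        nlinarith
    _ = κ ^ j := by simp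

/-- For `κ ≥ 1` the factors `(κ + l) / (l + 1)` decrease in `l`, so the last `j` of them are
dominated by the first `j`. -/
lemma divisorCoeff_add_le {κ : ℝ} (hκ : 1 ≤ κ) (i j : ℕ) :
    divisorCoeff κ (i + j) ≤ divisorCoeff κ i * divisorCoeff κ j := by
  unfold divisorCoeff
  rw [Finset.prod_range_add]
  refine mul_le_mul_of_nonneg_left ?_ (Finset.prod_nonneg fun i _ => by positivity)
  refine Finset.prod_le_prod (fun l _ => by positivity) fun l _ => ?_
  rw [div_le_div_iff₀ (by positivity) (by positivity)]
  push_cast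
  have : (0 : ℝ) ≤ i := i.cast_nonneg
  nlinarith

/-- Each factor `(κ + l) / (l + 1)` is a convex combination of `κ` and `1`; apply convexity of `x ↦
x ^ r` factor by factor. -/
lemma divisorCoeff_pow_le {κ : ℝ} (hκ : 1 ≤ κ) (r j : ℕ) :
    divisorCoeff κ j ^ r ≤ divisorCoeff (κ ^ r) j := by
  unfold divisorCoeff
  rw [← Finset.prod_pow]
  refine Finset.prod_le_prod (fun l _ => by positivity) fun l _ => ?_
  have h := (convexOn_pow (𝕜 := ℝ) r).2 (Set.mem_Ici.2 (zero_le_one.trans hκ))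
    (Set.mem_Ici.2 zero_le_one) (show (0 : ℝ) ≤ 1 / ((l : ℝ) + 1) by positivity)
    (show (0 : ℝ) ≤ l / ((l : ℝ) + 1) by positivity) (by field_simp; ring)
  simp only [smul_eq_mul, one_pow, mul_one] at h
  calc ((κ + l) / ((l : ℝ) + 1)) ^ r = (1 / ((l : ℝ) + 1) * κ + l / ((l : ℝ) + 1)) ^ r := by
        congr 1; ring
    _ ≤ _ := h
    _ = _ := by ring

lemma hasSum_divisorCoeff (κ : ℝ) {x : ℝ} (hx : |x| < 1) :
    HasSum (fun j => divisorCoeff κ j * x ^ j) ((1 - x) ^ (-κ)) := by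
  have hc : ∀ n : ℕ, Ring.choose (κ + n - 1) n = divisorCoeff κ n := by
    intro n
    have h := Ring.factorial_nsmul_multichoose_eq_ascPochhammer κ n
    rw [Polynomial.ascPochhammer_smeval_eq_eval, nsmul_eq_mul, Ring.multichoose_eq] at h
    have h2 : ∀ n : ℕ, (n.factorial : ℝ) * divisorCoeff κ n = (ascPochhammer ℝ n).eval κ := by
      intro n
      induction n with
      | zero => simp
      | succ n ih =>
        rw [ascPochhammer_succ_eval, ← ih, divisorCoeff_succ, Nat.factorial_succ]
        push_cast
        field_simp
    rw [← h2] at h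
    exact mul_left_cancel₀ (by positivity) h
  have h := (Real.one_div_one_sub_rpow_hasFPowerSeriesOnBall_zero κ).hasSum (y := x)
    (by
      rw [Metric.mem_eball, edist_zero_right, ← ofReal_norm, Real.norm_eq_abs]
      exact ENNReal.ofReal_lt_one.2 hx)
  simp only [FormalMultilinearSeries.ofScalars_apply_eq] at h
  simp only [hc, smul_eq_mul, zero_add] at h
  rwa [Real.rpow_neg (by linarith [(abs_lt.1 hx).2]), ← one_div]

lemma divisorFn_eq (κ : ℝ) (n : ℕ) :
    divisorFn κ n = n.factorization.prod fun _ j => divisorCoeff κ j := rfl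

@[simp] lemma divisorFn_one (κ : ℝ) : divisorFn κ 1 = 1 := by simp [divisorFn]

lemma divisorFn_prime_pow (κ : ℝ) {p : ℕ} (hp : p.Prime) (j : ℕ) :
    divisorFn κ (p ^ j) = divisorCoeff κ j := by
  rw [divisorFn_eq, hp.factorization_pow, Finsupp.prod_single_index (by simp)]

lemma divisorFn_eq_prod (κ : ℝ) {n : ℕ} {s : Finset ℕ} (h : n.primeFactors ⊆ s) :
    divisorFn κ n = ∏ p ∈ s, divisorCoeff κ (n.factorization p) := by
  rw [divisorFn_eq]
  exact Finsupp.prod_of_support_subset _ (by simpa using h) _ (by simp)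

lemma divisorFn_mul_of_coprime (κ : ℝ) {m n : ℕ} (h : m.Coprime n) :
    divisorFn κ (m * n) = divisorFn κ m * divisorFn κ n := by
  rw [divisorFn_eq, divisorFn_eq, divisorFn_eq, Nat.factorization_mul_of_coprime h,
    Finsupp.prod_add_index_of_disjoint]
  simpa using h.disjoint_primeFactors

lemma one_le_divisorFn {κ : ℝ} (hκ : 1 ≤ κ) (n : ℕ) : 1 ≤ divisorFn κ n := by
  rw [divisorFn_eq_prod κ subset_rfl]
  calc (1 : ℝ) = ∏ p ∈ n.primeFactors, 1 := by simp
    _ ≤ _ := Finset.prod_le_prod (fun _ _ => zero_le_one) fun p _ => one_le_divisorCoeff hκ _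

lemma divisorFn_mul_le {κ : ℝ} (hκ : 1 ≤ κ) {m n : ℕ} (hm : m ≠ 0) (hn : n ≠ 0) :
    divisorFn κ (m * n) ≤ divisorFn κ m * divisorFn κ n := by
  have h := Nat.primeFactors_mul hm hn
  rw [divisorFn_eq_prod κ h.le, divisorFn_eq_prod κ (n := m) Finset.subset_union_left,
    divisorFn_eq_prod κ (n := n) Finset.subset_union_right, ← Finset.prod_mul_distrib]
  refine Finset.prod_le_prod (fun p _ => zero_le_one.trans (one_le_divisorCoeff hκ _)) fun p _ => ?_
  rw [Nat.factorization_mul hm hn]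
  exact divisorCoeff_add_le hκ _ _

lemma divisorFn_pow_le {κ : ℝ} (hκ : 1 ≤ κ) (r n : ℕ) :
    divisorFn κ n ^ r ≤ divisorFn (κ ^ r) n := by
  rw [divisorFn_eq_prod κ subset_rfl, divisorFn_eq_prod _ subset_rfl, ← Finset.prod_pow]
  exact Finset.prod_le_prod
    (fun p _ => pow_nonneg (zero_le_one.trans (one_le_divisorCoeff hκ _)) _)
    fun p _ => divisorCoeff_pow_le hκ _ _

lemma divisorFn_le_pow_cardFactors {κ : ℝ} (hκ : 1 ≤ κ) (n : ℕ) :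
    divisorFn κ n ≤ κ ^ ArithmeticFunction.cardFactors n := by
  rw [divisorFn_eq_prod κ subset_rfl, ArithmeticFunction.cardFactors_eq_sum_factorization,
    Finsupp.sum, Nat.support_factorization, ← Finset.prod_pow_eq_pow_sum]
  exact Finset.prod_le_prod (fun p _ => zero_le_one.trans (one_le_divisorCoeff hκ _))
    fun p _ => divisorCoeff_le_pow hκ _

/-! ### Mean values and pointwise bounds from the Dirichlet series. -/

/-- Partial sums of the Dirichlet series of `divisorFn κ` are at most `ζ(s) ^ κ`. -/
lemma sum_divisorFn_rpow_le {κ : ℝ} (hκ : 1 ≤ κ) {s : ℝ} (hs : 1 < s) (N : ℕ) :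
    ∑ m ∈ Finset.Ico 1 N, divisorFn κ m * (m : ℝ) ^ (-s) ≤ (∑' n : ℕ, 1 / (n : ℝ) ^ s) ^ κ := by
  have hpow : ∀ p e : ℕ, ((p ^ e : ℕ) : ℝ) ^ (-s) = ((p : ℝ) ^ (-s)) ^ e := by
    intro p e
    rw [Nat.cast_pow, ← Real.rpow_natCast, ← Real.rpow_natCast, ← Real.rpow_mul (by positivity),
      ← Real.rpow_mul (by positivity), mul_comm]
  have hlt : ∀ {p : ℕ}, p.Prime → |(p : ℝ) ^ (-s)| < 1 := by
    intro p hp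
    rw [abs_of_nonneg (by positivity)]
    exact Real.rpow_lt_one_of_one_lt_of_neg (by exact_mod_cast hp.one_lt) (by linarith)
  have hf : ∀ κ : ℝ, 1 ≤ κ → HasSum (fun m : N.smoothNumbers => divisorFn κ m * (m : ℝ) ^ (-s))
      (∏ p ∈ N.primesBelow, (1 - (p : ℝ) ^ (-s)) ^ (-κ)) := by
    intro κ hκ
    have hS : ∀ {p : ℕ}, p.Prime →
        HasSum (fun e : ℕ => divisorFn κ (p ^ e) * ((p ^ e : ℕ) : ℝ) ^ (-s))
          ((1 - (p : ℝ) ^ (-s)) ^ (-κ)) := by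
      intro p hp
      simp only [hpow, divisorFn_prime_pow κ hp]
      exact hasSum_divisorCoeff κ (hlt hp)
    have h := (EulerProduct.summable_and_hasSum_smoothNumbers_prod_primesBelow_tsum
      (f := fun m : ℕ => divisorFn κ m * (m : ℝ) ^ (-s)) (by simp)
      (fun {m n} hmn => by
        rw [divisorFn_mul_of_coprime κ hmn, Nat.cast_mul,
          Real.mul_rpow (by positivity) (by positivity)]
        ring)
      (fun {p} hp => (hS hp).summable.norm) N).2
    rwa [Finset.prod_congr rfl fun p hp => (hS (Nat.prime_of_mem_primesBelow hp)).tsum_eq] at h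
  have hnn : ∀ κ : ℝ, 1 ≤ κ → ∀ m : ℕ, 0 ≤ divisorFn κ m * (m : ℝ) ^ (-s) := fun κ hκ m =>
    mul_nonneg (zero_le_one.trans (one_le_divisorFn hκ m)) (by positivity)
  have hone : ∀ m : ℕ, m ≠ 0 → divisorFn 1 m = 1 := by
    intro m _
    refine le_antisymm ?_ (one_le_divisorFn le_rfl m)
    simpa using divisorFn_le_pow_cardFactors le_rfl m
  have hsum : Summable fun n : ℕ => 1 / (n : ℝ) ^ s := Real.summable_one_div_nat_rpow.2 hs
  calc _ ≤ ∏ p ∈ N.primesBelow, (1 - (p : ℝ) ^ (-s)) ^ (-κ) := by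
        rw [← (hf κ hκ).tsum_eq]
        have := (hf κ hκ).summable.sum_le_tsum
          ((Finset.Ico 1 N).attach.image fun m => (⟨m.1, Nat.mem_smoothNumbers_of_lt
            (Finset.mem_Ico.1 m.2).1 (Finset.mem_Ico.1 m.2).2⟩ : N.smoothNumbers))
          (fun m _ => hnn κ hκ m)
        refine le_of_eq_of_le ?_ this
        rw [Finset.sum_image (by intro a _ b _ h; exact Subtype.ext (by simpa using h))]
        exact (Finset.sum_attach _ fun m : ℕ => divisorFn κ m * (m : ℝ) ^ (-s)).symm
    -- The finite Euler product is the `κ`-th power of the one for `κ = 1`, which sums `n ^ (-s)`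
    -- over smooth numbers and so is at most `ζ(s)`.
    _ = (∏ p ∈ N.primesBelow, (1 - (p : ℝ) ^ (-s)) ^ (-(1 : ℝ))) ^ κ := by
        rw [← Real.finsetProd_rpow _ _ fun p hp => ?_]
        · refine Finset.prod_congr rfl fun p hp => ?_
          rw [← Real.rpow_mul]
          · simp
          · linarith [(abs_lt.1 (hlt (Nat.prime_of_mem_primesBelow hp))).2]
        · refine Real.rpow_nonneg ?_ _
          linarith [(abs_lt.1 (hlt (Nat.prime_of_mem_primesBelow hp))).2]
    _ ≤ _ := by
        have h1 := hf 1 le_rfl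
        rw [← h1.tsum_eq]
        refine Real.rpow_le_rpow (tsum_nonneg fun m => hnn 1 le_rfl m) ?_ (by linarith)
        have : ∀ m : N.smoothNumbers, divisorFn 1 m * (m : ℝ) ^ (-s) = 1 / ((m : ℕ) : ℝ) ^ s := by
          intro m
          rw [hone m (Nat.ne_zero_of_mem_smoothNumbers m.2), one_mul, Real.rpow_neg (by positivity),
            one_div]
        simp_rw [this]
        exact hsum.tsum_subtype_le _ _ fun n => by positivity

/-- Rankin's trick with `s = 1 + 1 / log X`: replacing `1/m` by `m ^ (-s)` costs at most `e` for `m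
≤ X`, and the pole of `ζ` at `1` gives `ζ(s) ≤ 2 log X`. -/
lemma exists_sum_divisorFn_div_le {κ : ℝ} (hκ : 1 ≤ κ) :
    ∃ C X₀ : ℝ, 0 < C ∧ ∀ X : ℝ, X₀ ≤ X → ∀ N : ℕ, (N : ℝ) ≤ X →
      ∑ m ∈ Finset.Icc 1 N, divisorFn κ m / m ≤ C * Real.log X ^ κ := by
  have h1 : ∀ᶠ s : ℝ in 𝓝[>] 1, (s - 1) * ∑' n : ℕ, 1 / (n : ℝ) ^ s < 2 :=
    tendsto_sub_mul_tsum_nat_rpow.eventually_lt_const (by norm_num)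
  have h2 : Tendsto (fun X : ℝ => 1 + (Real.log X)⁻¹) atTop (𝓝[>] 1) := by
    refine tendsto_nhdsWithin_iff.2 ⟨?_, ?_⟩
    · simpa using (Real.tendsto_log_atTop.inv_tendsto_atTop).const_add 1
    · filter_upwards [eventually_gt_atTop 1] with X hX
      simpa using Real.log_pos hX
  obtain ⟨X₀, hX₀⟩ := eventually_atTop.1 ((h2.eventually h1).and (eventually_gt_atTop 1))
  refine ⟨Real.exp 1 * 2 ^ κ, X₀, by positivity, fun X hX N hN => ?_⟩
  obtain ⟨hz, hX1⟩ := hX₀ X hX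
  have hL : 0 < Real.log X := Real.log_pos hX1
  set s := 1 + (Real.log X)⁻¹ with hs
  have hs1 : 1 < s := by simpa [hs] using hL
  have hζ : ∑' n : ℕ, 1 / (n : ℝ) ^ s ≤ 2 * Real.log X := by
    rw [show s - 1 = (Real.log X)⁻¹ by simp [hs], inv_mul_lt_iff₀ hL] at hz
    linarith
  have hmain := sum_divisorFn_rpow_le hκ hs1 (N + 1)
  calc ∑ m ∈ Finset.Icc 1 N, divisorFn κ m / m
      ≤ ∑ m ∈ Finset.Icc 1 N, Real.exp 1 * (divisorFn κ m * (m : ℝ) ^ (-s)) := by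
        refine Finset.sum_le_sum fun m hm => ?_
        obtain ⟨hm1, hm2⟩ := Finset.mem_Icc.1 hm
        have hm0 : (0 : ℝ) < m := by exact_mod_cast hm1
        have hmX : (m : ℝ) ≤ X := le_trans (by exact_mod_cast hm2) hN
        have hd := zero_le_one.trans (one_le_divisorFn hκ m)
        have he : (m : ℝ) ^ (Real.log X)⁻¹ ≤ Real.exp 1 := by
          rw [Real.rpow_def_of_pos hm0, Real.exp_le_exp, ← div_eq_mul_inv, div_le_one hL]
          exact Real.log_le_log hm0 hmX
        have hm' : (m : ℝ)⁻¹ = (m : ℝ) ^ (Real.log X)⁻¹ * (m : ℝ) ^ (-s) := by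
          rw [← Real.rpow_add hm0, hs, show (Real.log X)⁻¹ + -(1 + (Real.log X)⁻¹) = -1 by ring,
            Real.rpow_neg_one]
        rw [div_eq_mul_inv, hm']
        calc divisorFn κ m * ((m : ℝ) ^ (Real.log X)⁻¹ * (m : ℝ) ^ (-s))
            ≤ divisorFn κ m * (Real.exp 1 * (m : ℝ) ^ (-s)) := by gcongr
          _ = _ := by ring
    _ = Real.exp 1 * ∑ m ∈ Finset.Ico 1 (N + 1), divisorFn κ m * (m : ℝ) ^ (-s) := by
        rw [Finset.mul_sum]; rfl
    _ ≤ Real.exp 1 * (2 * Real.log X) ^ κ := by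
        gcongr
        refine hmain.trans (Real.rpow_le_rpow (tsum_nonneg fun n => by positivity) hζ (by linarith))
    _ = _ := by rw [Real.mul_rpow (by norm_num) hL.le]; ring

lemma exists_sum_inv_le :
    ∃ C X₀ : ℝ, 0 < C ∧ ∀ X : ℝ, X₀ ≤ X → ∀ N : ℕ, (N : ℝ) ≤ X →
      ∑ m ∈ Finset.Icc 1 N, (m : ℝ)⁻¹ ≤ C * Real.log X := by
  obtain ⟨C, X₀, hC, h⟩ := exists_sum_divisorFn_div_le le_rfl
  refine ⟨C, X₀, hC, fun X hX N hN => ?_⟩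
  refine le_trans (Finset.sum_le_sum fun m _ => ?_) ((h X hX N hN).trans_eq (by rw [Real.rpow_one]))
  rw [← one_div]
  gcongr
  exact one_le_divisorFn le_rfl m

/-- The `r`-th power is dominated by the divisor function of order `κ ^ r`, a single term of whose
Dirichlet series at `2` is at most the whole. The exponent `2` does not depend on `r`, so letting
`r` grow gives `d_κ(n) = n ^ o(1)`. -/
lemma exists_divisorFn_pow_le {κ : ℝ} (hκ : 1 ≤ κ) (r : ℕ) :
    ∃ C : ℝ, 1 ≤ C ∧ ∀ n : ℕ, 1 ≤ n → divisorFn κ n ^ r ≤ C * (n : ℝ) ^ 2 := by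
  have hκr : 1 ≤ κ ^ r := one_le_pow₀ hκ
  refine ⟨max 1 ((∑' n : ℕ, 1 / (n : ℝ) ^ (2 : ℝ)) ^ (κ ^ r)), le_max_left _ _, fun n hn => ?_⟩
  have h := sum_divisorFn_rpow_le hκr (s := 2) (by norm_num) (n + 1)
  have hn0 : (0 : ℝ) < n := by exact_mod_cast hn
  have h1 : divisorFn (κ ^ r) n * (n : ℝ) ^ (-(2 : ℝ)) ≤
      (∑' n : ℕ, 1 / (n : ℝ) ^ (2 : ℝ)) ^ (κ ^ r) := by
    refine le_trans (Finset.single_le_sum (f := fun m : ℕ =>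
      divisorFn (κ ^ r) m * (m : ℝ) ^ (-(2 : ℝ))) (fun m _ => ?_)
      (Finset.mem_Ico.2 ⟨hn, Nat.lt_succ_self n⟩)) h
    exact mul_nonneg (zero_le_one.trans (one_le_divisorFn hκr m)) (by positivity)
  refine (divisorFn_pow_le hκ r n).trans ?_
  rw [Real.rpow_neg hn0.le, ← div_eq_mul_inv, div_le_iff₀ (by positivity)] at h1
  rw [Real.rpow_ofNat] at h1
  refine h1.trans ?_
  gcongr
  exact le_max_right _ _

/-- The maximum of `divisorFn κ` over `{1, …, ⌊y⌋}`, or `1` if that is larger. -/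
noncomputable def divisorMax (κ y : ℝ) : ℝ :=
  (insert 1 (Finset.Icc 1 ⌊y⌋₊)).sup' (Finset.insert_nonempty _ _) (divisorFn κ)

lemma one_le_divisorMax (κ y : ℝ) : 1 ≤ divisorMax κ y := by
  unfold divisorMax
  exact (divisorFn_one κ).symm.le.trans
    (Finset.le_sup' (divisorFn κ) (Finset.mem_insert_self _ _))

lemma divisorFn_le_divisorMax (κ : ℝ) {y : ℝ} {n : ℕ} (hn : 1 ≤ n) (hny : (n : ℝ) ≤ y) :
    divisorFn κ n ≤ divisorMax κ y := by
  unfold divisorMax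
  exact Finset.le_sup' (divisorFn κ)
    (Finset.mem_insert_of_mem (Finset.mem_Icc.2 ⟨hn, Nat.le_floor hny⟩))

lemma tendsto_log_divisorMax {κ : ℝ} (hκ : 1 ≤ κ) {A : ℝ} (hA : 0 ≤ A) :
    Tendsto (fun X : ℝ => Real.log (divisorMax κ (Real.log X ^ A)) / Real.log (Real.log X))
      atTop (𝓝 0) := by
  have hLL : Tendsto (fun X : ℝ => Real.log (Real.log X)) atTop atTop :=
    Real.tendsto_log_atTop.comp Real.tendsto_log_atTop
  rw [Metric.tendsto_atTop']
  intro ε hε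
  -- The `2 * A` pays for `(log X) ^ (2A)`; the extra `1` absorbs `log C < log log X`.
  obtain ⟨r, hr⟩ := exists_nat_gt ((2 * A + 1) / ε)
  have hr0 : (0 : ℝ) < r := lt_of_le_of_lt (by positivity) hr
  obtain ⟨C, hC1, hC⟩ := exists_divisorFn_pow_le hκ r
  obtain ⟨X₀, hX₀⟩ := eventually_atTop.1
    (((hLL.eventually_gt_atTop (Real.log C)).and (hLL.eventually_gt_atTop 0)).and
      (Real.tendsto_log_atTop.eventually_gt_atTop 1))
  refine ⟨X₀, fun X hX => ?_⟩
  obtain ⟨⟨h1, h2⟩, h3⟩ := hX₀ X hX.le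
  have hL0 : 0 < Real.log X := by linarith
  have hG := one_le_divisorMax κ (Real.log X ^ A)
  rw [Real.dist_eq, sub_zero, abs_of_nonneg (div_nonneg (Real.log_nonneg hG) h2.le),
    div_lt_iff₀ h2]
  have hmax : divisorMax κ (Real.log X ^ A) ^ r ≤ C * (Real.log X ^ A) ^ 2 := by
    obtain ⟨n, hn, hn'⟩ := Finset.exists_mem_eq_sup' (Finset.insert_nonempty 1
      (Finset.Icc 1 ⌊Real.log X ^ A⌋₊)) (divisorFn κ)
    rw [divisorMax, hn']
    have hA1 : 1 ≤ Real.log X ^ A := Real.one_le_rpow h3.le hA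
    have : 1 ≤ n ∧ (n : ℝ) ≤ Real.log X ^ A := by
      rcases Finset.mem_insert.1 hn with rfl | hn
      · exact ⟨le_rfl, by simpa using hA1⟩
      · exact ⟨(Finset.mem_Icc.1 hn).1, (Nat.le_floor_iff (by linarith)).1 (Finset.mem_Icc.1 hn).2⟩
    refine (hC n this.1).trans ?_
    gcongr
    exact this.2
  have h4 := Real.log_le_log (by positivity) hmax
  rw [Real.log_pow, Real.log_mul (by positivity) (by positivity), Real.log_pow,
    Real.log_rpow hL0] at h4
  push_cast at h4
  rw [div_lt_iff₀ hε] at hr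
  have h5 : (r : ℝ) * Real.log (divisorMax κ (Real.log X ^ A)) <
      r * (ε * Real.log (Real.log X)) := by nlinarith
  exact lt_of_mul_lt_mul_left h5 hr0.le

/-! ### Multiples of one or two moduli in short blocks. -/

/-- With `m₁ = g a` and `m₂ = g b`, `g` the gcd, the lcm is `g a b`, and the pair is recovered from
`(g, a, b)`. -/
lemma sum_inv_lcm_le (N : ℕ) :
    ∑ m₁ ∈ Finset.Icc 1 N, ∑ m₂ ∈ Finset.Icc 1 N, ((m₁.lcm m₂ : ℕ) : ℝ)⁻¹ ≤
      (∑ m ∈ Finset.Icc 1 N, (m : ℝ)⁻¹) ^ 3 := by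
  set T := Finset.Icc 1 N
  have e : (∑ m ∈ T, (m : ℝ)⁻¹) ^ 3 =
      ∑ p ∈ T ×ˢ T ×ˢ T, (p.1 : ℝ)⁻¹ * ((p.2.1 : ℝ)⁻¹ * (p.2.2 : ℝ)⁻¹) := by
    rw [Finset.sum_product, pow_three, Finset.sum_mul]
    refine Finset.sum_congr rfl fun a _ => ?_
    rw [Finset.sum_product, Finset.sum_mul, Finset.mul_sum]
    refine Finset.sum_congr rfl fun b _ => ?_
    rw [Finset.mul_sum, Finset.mul_sum]
  rw [e, ← Finset.sum_product']
  have hpos : ∀ p ∈ T ×ˢ T, 0 < p.1 ∧ p.1 ≤ N ∧ 0 < p.2 ∧ p.2 ≤ N := by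
    intro p hp
    simp only [T, Finset.mem_product, Finset.mem_Icc] at hp
    omega
  have hdec : ∀ p ∈ T ×ˢ T, p.1.gcd p.2 * (p.1 / p.1.gcd p.2) = p.1 ∧
      p.1.gcd p.2 * (p.2 / p.1.gcd p.2) = p.2 := fun p _ =>
    ⟨Nat.mul_div_cancel' (Nat.gcd_dvd_left _ _), Nat.mul_div_cancel' (Nat.gcd_dvd_right _ _)⟩
  have hinj : Set.InjOn (fun p : ℕ × ℕ => (p.1.gcd p.2, p.1 / p.1.gcd p.2, p.2 / p.1.gcd p.2))
      (T ×ˢ T : Finset (ℕ × ℕ)) := by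
    intro p hp r hr h
    simp only [Prod.mk.injEq] at h
    obtain ⟨h1, h2, h3⟩ := h
    refine Prod.ext ?_ ?_
    · rw [← (hdec p hp).1, ← (hdec r hr).1, h2, h1]
    · rw [← (hdec p hp).2, ← (hdec r hr).2, h3, h1]
  refine le_trans (le_of_eq ?_) (Finset.sum_le_sum_of_subset_of_nonneg
    (s := (T ×ˢ T).image
      fun p : ℕ × ℕ => (p.1.gcd p.2, p.1 / p.1.gcd p.2, p.2 / p.1.gcd p.2)) ?_
    fun p _ _ => by positivity)
  · rw [Finset.sum_image hinj]
    refine Finset.sum_congr rfl fun p hp => ?_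
    simp only
    rw [← mul_inv, ← mul_inv, ← Nat.cast_mul, ← Nat.cast_mul]
    congr 2
    refine Nat.eq_of_mul_eq_mul_left (Nat.gcd_pos_of_pos_left p.2 (hpos p hp).1) ?_
    rw [Nat.gcd_mul_lcm]
    calc p.1 * p.2 = (p.1.gcd p.2 * (p.1 / p.1.gcd p.2)) * (p.1.gcd p.2 * (p.2 / p.1.gcd p.2)) := by
          rw [(hdec p hp).1, (hdec p hp).2]
      _ = _ := by ring
  · intro t ht
    obtain ⟨p, hp, rfl⟩ := Finset.mem_image.1 ht
    obtain ⟨h1, h2, h3, h4⟩ := hpos p hp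
    have hg := Nat.gcd_pos_of_pos_left p.2 h1
    simp only [T, Finset.mem_product, Finset.mem_Icc]
    exact ⟨⟨hg, (Nat.gcd_le_left _ h1).trans h2⟩,
      ⟨Nat.div_pos (Nat.gcd_le_left _ h1) hg, (Nat.div_le_self _ _).trans h2⟩,
      Nat.div_pos (Nat.gcd_le_right _ h3) hg, (Nat.div_le_self _ _).trans h4⟩

lemma abs_card_filter_modEq_sub_le {l : ℕ} (hl : 0 < l) (v Y : ℕ) :
    |(((Finset.range Y).filter (fun y => y ≡ v [MOD l])).card : ℝ) - Y / l| ≤ 1 := by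
  rw [← Nat.count_eq_card_filter_range, Nat.count_modEq_card _ hl]
  have hl' : (0 : ℝ) < l := by exact_mod_cast hl
  have h1 : ((Y / l : ℕ) : ℝ) ≤ Y / l := Nat.cast_div_le
  have h2 : (Y : ℝ) / l < (Y / l : ℕ) + 1 := by
    rw [div_lt_iff₀ hl']
    have := Nat.lt_mul_div_succ Y hl
    rw [mul_comm]
    exact_mod_cast this
  split_ifs with h
  · push_cast
    rw [abs_le]
    constructor <;> linarith
  · push_cast
    rw [abs_le]
    constructor <;> linarith

/-- Chinese remainder theorem: the two conditions are compatible exactly when `r ≡ s` modulo the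
gcd, and then define one class modulo the lcm. Keeping the count indexed by `(r, s)` allows a later
twist. -/
lemma abs_card_filter_dvd_dvd_sub_le {m₁ m₂ : ℕ} (h₁ : 0 < m₁) (h₂ : 0 < m₂) (r s Y : ℕ) :
    |(((Finset.range Y).filter (fun y => m₁ ∣ y + r ∧ m₂ ∣ y + s)).card : ℝ) -
      (if s ≡ r [MOD m₁.gcd m₂] then (Y : ℝ) / (m₁.lcm m₂ : ℕ) else 0)| ≤
      if s ≡ r [MOD m₁.gcd m₂] then 1 else 0 := by
  have hv : ∀ m r : ℕ, 0 < m → m ∣ (m - 1) * r + r := by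
    intro m r hm
    rw [← Nat.succ_mul, Nat.succ_eq_add_one, Nat.sub_add_cancel hm]
    exact dvd_mul_right _ _
  have hmod : ∀ {m y v r : ℕ}, m ∣ v + r → (m ∣ y + r ↔ y ≡ v [MOD m]) := by
    intro m y v r h
    constructor
    · intro h'
      exact Nat.ModEq.add_right_cancel' r
        ((Nat.modEq_zero_iff_dvd.2 h').trans (Nat.modEq_zero_iff_dvd.2 h).symm)
    · intro h'
      exact Nat.modEq_zero_iff_dvd.1 ((h'.add_right r).trans (Nat.modEq_zero_iff_dvd.2 h))
  split_ifs with h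
  · have hc : (m₁ - 1) * r ≡ (m₂ - 1) * s [MOD m₁.gcd m₂] := by
      refine Nat.ModEq.add_right_cancel h.symm ?_
      exact (Nat.modEq_zero_iff_dvd.2 ((Nat.gcd_dvd_left _ _).trans (hv m₁ r h₁))).trans
        (Nat.modEq_zero_iff_dvd.2 ((Nat.gcd_dvd_right _ _).trans (hv m₂ s h₂))).symm
    obtain ⟨v, hv1, hv2⟩ := Nat.chineseRemainder' hc
    have e : ∀ y, (m₁ ∣ y + r ∧ m₂ ∣ y + s) ↔ y ≡ v [MOD m₁.lcm m₂] := by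
      intro y
      have hl : y ≡ v [MOD m₁.lcm m₂] ↔ y ≡ v [MOD m₁] ∧ y ≡ v [MOD m₂] := by
        simp only [← Int.natCast_modEq_iff]
        exact (Int.modEq_and_modEq_iff_modEq_lcm (m := m₁) (n := m₂)).symm
      rw [hmod (hv m₁ r h₁), hmod (hv m₂ s h₂), hl]
      exact and_congr ⟨fun h => h.trans hv1.symm, fun h => h.trans hv1⟩
        ⟨fun h => h.trans hv2.symm, fun h => h.trans hv2⟩
    simp only [e]
    exact abs_card_filter_modEq_sub_le (Nat.lcm_pos h₁ h₂) v Y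
  · rw [Finset.filter_eq_empty_iff.2]
    · simp
    · rintro y - ⟨h3, h4⟩
      refine h (Nat.ModEq.add_left_cancel' y ?_)
      exact (Nat.modEq_zero_iff_dvd.2 ((Nat.gcd_dvd_right _ _).trans h4)).trans
        (Nat.modEq_zero_iff_dvd.2 ((Nat.gcd_dvd_left _ _).trans h3)).symm

/-- The number of multiples of `m` among `y, …, y + B - 1`. -/
noncomputable def multCount (m B y : ℕ) : ℝ :=
  ∑ r ∈ Finset.range B, if m ∣ y + r then 1 else 0

lemma le_sum_multCount {m : ℕ} (hm : 0 < m) (B Y : ℕ) :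
    (B : ℝ) * Y / m - B ≤ ∑ y ∈ Finset.range Y, multCount m B y := by
  simp only [multCount]
  rw [Finset.sum_comm]
  have h : ∀ r ∈ Finset.range B, (Y : ℝ) / m - 1 ≤
      ∑ y ∈ Finset.range Y, if m ∣ y + r then (1 : ℝ) else 0 := by
    intro r _
    have := abs_card_filter_dvd_dvd_sub_le hm hm r r Y
    simp only [and_self, Nat.ModEq.refl, if_true, Nat.lcm_self] at this
    rw [Finset.sum_boole]
    linarith [(abs_le.1 this).1]
  refine le_trans (le_of_eq ?_) (Finset.sum_le_sum h)
  simp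
  ring

lemma sum_multCount_mul_le {m₁ m₂ : ℕ} (h₁ : 0 < m₁) (h₂ : 0 < m₂) (B Y : ℕ) :
    ∑ y ∈ Finset.range Y, multCount m₁ B y * multCount m₂ B y ≤
      Y * B ^ 2 / (m₁ * m₂) + Y * B / (m₁.lcm m₂ : ℕ) + B ^ 2 := by
  have hg := Nat.gcd_pos_of_pos_left m₂ h₁
  have hl := Nat.lcm_pos h₁ h₂
  have hg' : (0 : ℝ) < (m₁.gcd m₂ : ℕ) := by exact_mod_cast hg
  have hl' : (0 : ℝ) < (m₁.lcm m₂ : ℕ) := by exact_mod_cast hl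
  have hgl : ((m₁.gcd m₂ : ℕ) : ℝ) * (m₁.lcm m₂ : ℕ) = m₁ * m₂ := by
    exact_mod_cast Nat.gcd_mul_lcm m₁ m₂
  have e : ∑ y ∈ Finset.range Y, multCount m₁ B y * multCount m₂ B y =
      ∑ r ∈ Finset.range B, ∑ s ∈ Finset.range B,
        (((Finset.range Y).filter (fun y => m₁ ∣ y + r ∧ m₂ ∣ y + s)).card : ℝ) := by
    simp only [multCount, Finset.sum_mul_sum]
    rw [Finset.sum_comm]
    refine Finset.sum_congr rfl fun r _ => ?_
    rw [Finset.sum_comm]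
    refine Finset.sum_congr rfl fun s _ => ?_
    rw [← Finset.sum_boole]
    refine Finset.sum_congr rfl fun y _ => ?_
    simp only [← ite_and, mul_ite, mul_one, mul_zero, and_comm]
  rw [e]
  have hrow : ∀ r ∈ Finset.range B, ∑ s ∈ Finset.range B,
      (((Finset.range Y).filter (fun y => m₁ ∣ y + r ∧ m₂ ∣ y + s)).card : ℝ) ≤
      ((B : ℝ) / (m₁.gcd m₂ : ℕ) + 1) * (Y / (m₁.lcm m₂ : ℕ)) + B := by
    intro r _
    calc _ ≤ ∑ s ∈ Finset.range B, ((if s ≡ r [MOD m₁.gcd m₂] then (1 : ℝ) else 0) *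
            (Y / (m₁.lcm m₂ : ℕ)) + 1) := by
          refine Finset.sum_le_sum fun s _ => ?_
          have := abs_card_filter_dvd_dvd_sub_le h₁ h₂ r s Y
          split_ifs at this ⊢ <;> linarith [(abs_le.1 this).2]
      _ ≤ _ := by
          rw [Finset.sum_add_distrib, ← Finset.sum_mul, Finset.sum_boole]
          simp only [Finset.sum_const, Finset.card_range, nsmul_eq_mul, mul_one]
          gcongr
          linarith [(abs_le.1 (abs_card_filter_modEq_sub_le hg r B)).2]
  refine (Finset.sum_le_sum hrow).trans (le_of_eq ?_)
  simp only [Finset.sum_const, Finset.card_range, nsmul_eq_mul]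
  rw [← hgl]
  field_simp

/-- On expanding, the terms `Y * B ^ 2 / (m₁ * m₂)` from the product, the two cross terms and the
constant cancel. The lcm term survives from rounding the number of offsets congruent mod the gcd. -/
lemma sum_multCount_sub_mul_le {m₁ m₂ : ℕ} (h₁ : 0 < m₁) (h₂ : 0 < m₂) (B Y : ℕ) :
    ∑ y ∈ Finset.range Y, (multCount m₁ B y - B / m₁) * (multCount m₂ B y - B / m₂) ≤
      Y * B / (m₁.lcm m₂ : ℕ) + 3 * B ^ 2 := by
  have e : ∑ y ∈ Finset.range Y, (multCount m₁ B y - B / m₁) * (multCount m₂ B y - B / m₂) =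
      ∑ y ∈ Finset.range Y, multCount m₁ B y * multCount m₂ B y
        - B / m₂ * ∑ y ∈ Finset.range Y, multCount m₁ B y
        - B / m₁ * ∑ y ∈ Finset.range Y, multCount m₂ B y + Y * (B / m₁ * (B / m₂)) := by
    rw [Finset.mul_sum, Finset.mul_sum, ← Finset.sum_sub_distrib, ← Finset.sum_sub_distrib]
    rw [show (Y : ℝ) * (B / m₁ * (B / m₂)) =
      ∑ y ∈ Finset.range Y, (B / m₁ * (B / m₂) : ℝ) by simp, ← Finset.sum_add_distrib]
    exact Finset.sum_congr rfl fun y _ => by ring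
  have hm₁ : (1 : ℝ) ≤ m₁ := by exact_mod_cast h₁
  have hm₂ : (1 : ℝ) ≤ m₂ := by exact_mod_cast h₂
  have i1 := mul_le_mul_of_nonneg_left (le_sum_multCount h₁ B Y)
    (show (0 : ℝ) ≤ B / m₂ by positivity)
  have i2 := mul_le_mul_of_nonneg_left (le_sum_multCount h₂ B Y)
    (show (0 : ℝ) ≤ B / m₁ by positivity)
  have i3 := sum_multCount_mul_le h₁ h₂ B Y
  have j1 : (B : ℝ) / m₂ * B ≤ B ^ 2 := by
    rw [div_mul_eq_mul_div, ← sq]; exact div_le_self (by positivity) hm₂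
  have j2 : (B : ℝ) / m₁ * B ≤ B ^ 2 := by
    rw [div_mul_eq_mul_div, ← sq]; exact div_le_self (by positivity) hm₁
  have k1 : (B : ℝ) / m₂ * (B * Y / m₁ - B) = Y * B ^ 2 / (m₁ * m₂) - B / m₂ * B := by
    field_simp
  have k2 : (B : ℝ) / m₁ * (B * Y / m₂ - B) = Y * B ^ 2 / (m₁ * m₂) - B / m₁ * B := by
    field_simp
  have k3 : (Y : ℝ) * (B / m₁ * (B / m₂)) = Y * B ^ 2 / (m₁ * m₂) := by field_simp
  rw [e]
  linarith

/-- The variance in short intervals of a sum of divisor weights. -/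
lemma sum_sq_multCount_sub_le {S : Finset ℕ} (hS : ∀ m ∈ S, 0 < m) {w : ℕ → ℝ}
    (hw : ∀ m ∈ S, 0 ≤ w m) (B Y : ℕ) :
    ∑ y ∈ Finset.range Y, (∑ m ∈ S, w m * (multCount m B y - B / m)) ^ 2 ≤
      Y * B * ∑ m₁ ∈ S, ∑ m₂ ∈ S, w m₁ * w m₂ * ((m₁.lcm m₂ : ℕ) : ℝ)⁻¹ +
        3 * B ^ 2 * (∑ m ∈ S, w m) ^ 2 := by
  have e : ∑ y ∈ Finset.range Y, (∑ m ∈ S, w m * (multCount m B y - B / m)) ^ 2 =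
      ∑ m₁ ∈ S, ∑ m₂ ∈ S, w m₁ * w m₂ * ∑ y ∈ Finset.range Y,
        (multCount m₁ B y - B / m₁) * (multCount m₂ B y - B / m₂) := by
    simp only [sq, Finset.sum_mul_sum]
    simp only [Finset.mul_sum]
    rw [Finset.sum_comm]
    refine Finset.sum_congr rfl fun m₁ _ => ?_
    rw [Finset.sum_comm]
    refine Finset.sum_congr rfl fun m₂ _ => Finset.sum_congr rfl fun y _ => by ring
  rw [e, sq (∑ m ∈ S, w m), Finset.sum_mul_sum, Finset.mul_sum, Finset.mul_sum,
    ← Finset.sum_add_distrib]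
  refine Finset.sum_le_sum fun m₁ hm₁ => ?_
  rw [Finset.mul_sum, Finset.mul_sum, ← Finset.sum_add_distrib]
  refine Finset.sum_le_sum fun m₂ hm₂ => ?_
  refine (mul_le_mul_of_nonneg_left (sum_multCount_sub_mul_le (hS _ hm₁) (hS _ hm₂) B Y)
    (mul_nonneg (hw _ hm₁) (hw _ hm₂))).trans (le_of_eq ?_)
  ring

/-! ### Second moments twisted by a root of unity. -/

lemma norm_geom_sum_le_of_pow_eq_one {u : ℂ} {q : ℕ} (hq : 0 < q) (hu : u ^ q = 1) (hu1 : u ≠ 1)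
    (T : ℕ) : ‖∑ t ∈ Finset.range T, u ^ t‖ ≤ q := by
  have hn : ‖u‖ = 1 := Complex.norm_eq_one_of_pow_eq_one hu hq.ne'
  -- Complete periods of length `q` sum to zero, leaving fewer than `q` terms of modulus one.
  have e : ∑ t ∈ Finset.range T, u ^ t = ∑ t ∈ Finset.range (T % q), u ^ t := by
    rw [geom_sum_eq hu1, geom_sum_eq hu1]
    congr 2
    conv_lhs => rw [← Nat.div_add_mod T q, pow_add, pow_mul, hu, one_pow, one_mul]
  rw [e]
  refine (norm_sum_le _ _).trans ?_
  simp only [norm_pow, hn, one_pow, Finset.sum_const, Finset.card_range, nsmul_eq_mul, mul_one]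
  exact_mod_cast (Nat.mod_lt T hq).le

/-- The class of `r` mod `g` is an arithmetic progression from `r % g`, along which `z ^ s` is
geometric with ratio `z ^ g`. -/
lemma norm_sum_filter_modEq_pow_le {z : ℂ} {q g : ℕ} (hq : 0 < q) (hg : 0 < g) (hz : z ^ q = 1)
    (hzg : z ^ g ≠ 1) (r B : ℕ) :
    ‖∑ s ∈ (Finset.range B).filter (fun s => s ≡ r [MOD g]), z ^ s‖ ≤ q := by
  have hn : ‖z‖ = 1 := Complex.norm_eq_one_of_pow_eq_one hz hq.ne'
  have e : (Finset.range B).filter (fun s => s ≡ r [MOD g]) =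
      (Finset.range ((B - r % g + g - 1) / g)).image (fun t => r % g + g * t) := by
    ext s
    simp only [Finset.mem_filter, Finset.mem_range, Finset.mem_image]
    have hlt : ∀ t, t < (B - r % g + g - 1) / g ↔ r % g + g * t < B := by
      intro t
      rw [← Nat.succ_le_iff, Nat.le_div_iff_mul_le hg, Nat.succ_mul, mul_comm t g]
      omega
    simp only [hlt]
    constructor
    · rintro ⟨h1, h2⟩
      have : r % g + g * (s / g) = s := by rw [← h2]; exact Nat.mod_add_div s g
      exact ⟨s / g, this.symm ▸ h1, this⟩
    · rintro ⟨t, h1, rfl⟩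
      exact ⟨h1, by simp [Nat.ModEq]⟩
  rw [e, Finset.sum_image (fun a _ b _ h => Nat.eq_of_mul_eq_mul_left hg (by simpa using h))]
  simp only [pow_add, pow_mul]
  rw [← Finset.mul_sum, norm_mul, norm_pow, hn, one_pow, one_mul]
  exact norm_geom_sum_le_of_pow_eq_one hq (by rw [← pow_mul, mul_comm, pow_mul, hz, one_pow]) hzg _

/-- The sum of `z ^ n` over the multiples `n` of `m` among `y, …, y + B - 1`. -/
noncomputable def multExpSum (z : ℂ) (m B y : ℕ) : ℂ :=
  ∑ r ∈ Finset.range B, if m ∣ y + r then z ^ (y + r) else 0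

lemma norm_sum_multExpSum_mul_conj_le {z : ℂ} {q m₁ m₂ : ℕ} (hq : 0 < q) (hz : z ^ q = 1)
    (h₁ : 0 < m₁) (h₂ : 0 < m₂) (hz₁ : z ^ m₁ ≠ 1) (B Y : ℕ) :
    ‖∑ y ∈ Finset.range Y, multExpSum z m₁ B y * starRingEnd ℂ (multExpSum z m₂ B y)‖ ≤
      Y * B * q * ((m₁.lcm m₂ : ℕ) : ℝ)⁻¹ + B ^ 2 := by
  have hn : ‖z‖ = 1 := Complex.norm_eq_one_of_pow_eq_one hz hq.ne'
  have hg := Nat.gcd_pos_of_pos_left m₂ h₁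
  set g := m₁.gcd m₂
  set l := m₁.lcm m₂
  -- Nontriviality on `m₁` passes to its divisor `g`, so the hypothesis is needed for only one of
  -- the two moduli.
  have hzg : z ^ g ≠ 1 := by
    intro h
    obtain ⟨c, hc⟩ : g ∣ m₁ := Nat.gcd_dvd_left _ _
    exact hz₁ (by rw [hc, pow_mul, h, one_pow])
  set z' := starRingEnd ℂ z
  have hz' : z' ^ q = 1 := by rw [← map_pow, hz, map_one]
  have hzg' : z' ^ g ≠ 1 := by
    intro h
    apply hzg
    have := congrArg (starRingEnd ℂ) h
    rwa [map_pow, map_one, Complex.conj_conj] at this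
  have hzz : ∀ y : ℕ, z ^ y * z' ^ y = 1 := by
    intro y
    rw [← mul_pow, Complex.mul_conj, Complex.normSq_eq_norm_sq, hn]
    simp
  have hn' : ‖z'‖ = 1 := by rw [RCLike.norm_conj, hn]
  let c : ℕ → ℕ → ℝ := fun r s =>
    (((Finset.range Y).filter (fun y => m₁ ∣ y + r ∧ m₂ ∣ y + s)).card : ℝ)
  have e : ∑ y ∈ Finset.range Y, multExpSum z m₁ B y * starRingEnd ℂ (multExpSum z m₂ B y) =
      ∑ r ∈ Finset.range B, ∑ s ∈ Finset.range B, (c r s : ℂ) * (z ^ r * z' ^ s) := by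
    simp only [multExpSum, map_sum, Finset.sum_mul_sum]
    rw [Finset.sum_comm]
    refine Finset.sum_congr rfl fun r _ => ?_
    rw [Finset.sum_comm]
    refine Finset.sum_congr rfl fun s _ => ?_
    simp only [c]
    rw [← Finset.sum_boole, Complex.ofReal_sum, Finset.sum_mul]
    refine Finset.sum_congr rfl fun y _ => ?_
    by_cases ha : m₁ ∣ y + r <;> by_cases hb : m₂ ∣ y + s <;> simp [ha, hb]
    rw [pow_add, pow_add]
    linear_combination (z ^ r * z' ^ s) * hzz y
  -- Replace each count by its expected value: the main part has geometric inner sums, and each of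
  -- the `B ^ 2` remainders is at most `1`.
  have hsplit : ∑ r ∈ Finset.range B, ∑ s ∈ Finset.range B, (c r s : ℂ) * (z ^ r * z' ^ s) =
      ((Y : ℂ) / l) * ∑ r ∈ Finset.range B,
        z ^ r * ∑ s ∈ (Finset.range B).filter (fun s => s ≡ r [MOD g]), z' ^ s +
      ∑ r ∈ Finset.range B, ∑ s ∈ Finset.range B,
        ((c r s - (if s ≡ r [MOD g] then (Y : ℝ) / l else 0) : ℝ) : ℂ) * (z ^ r * z' ^ s) := by
    rw [Finset.mul_sum, ← Finset.sum_add_distrib]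
    refine Finset.sum_congr rfl fun r _ => ?_
    rw [Finset.sum_filter, Finset.mul_sum, Finset.mul_sum, ← Finset.sum_add_distrib]
    refine Finset.sum_congr rfl fun s _ => ?_
    split_ifs <;> push_cast <;> ring
  rw [e, hsplit]
  refine (norm_add_le _ _).trans (add_le_add ?_ ?_)
  · rw [norm_mul, norm_div, Complex.norm_natCast, Complex.norm_natCast]
    have : ‖∑ r ∈ Finset.range B,
        z ^ r * ∑ s ∈ (Finset.range B).filter (fun s => s ≡ r [MOD g]), z' ^ s‖ ≤ B * q := by
      refine (norm_sum_le _ _).trans ?_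
      refine (Finset.sum_le_sum (g := fun _ => (q : ℝ)) fun r _ => ?_).trans (by simp)
      rw [norm_mul, norm_pow, hn, one_pow, one_mul]
      exact norm_sum_filter_modEq_pow_le hq hg hz' hzg' r B
    calc _ ≤ (Y : ℝ) / l * (B * q) := by gcongr
      _ = _ := by rw [div_eq_mul_inv]; ring
  · refine (norm_sum_le _ _).trans ?_
    refine (Finset.sum_le_sum (g := fun _ => (B : ℝ)) fun r _ => ?_).trans (by simp [sq])
    refine (norm_sum_le _ _).trans ?_
    refine (Finset.sum_le_sum (g := fun _ => (1 : ℝ)) fun s _ => ?_).trans (by simp)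
    rw [norm_mul, norm_mul, norm_pow, norm_pow, hn, hn', one_pow, one_pow, mul_one, mul_one,
      Complex.norm_real, Real.norm_eq_abs]
    refine (abs_card_filter_dvd_dvd_sub_le h₁ h₂ r s Y).trans ?_
    split_ifs <;> norm_num

/-- The second moment in short intervals of a sum of divisor weights twisted by a root of unity
that is nontrivial on each of the divisors. -/
lemma sum_norm_sq_multExpSum_le {S : Finset ℕ} {z : ℂ} {q : ℕ} (hq : 0 < q) (hz : z ^ q = 1)
    (hS : ∀ m ∈ S, 0 < m) (hzS : ∀ m ∈ S, z ^ m ≠ 1) {w : ℕ → ℝ}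
    (hw : ∀ m ∈ S, 0 ≤ w m) (B Y : ℕ) :
    ∑ y ∈ Finset.range Y, ‖∑ m ∈ S, (w m : ℂ) * multExpSum z m B y‖ ^ 2 ≤
      Y * B * q * ∑ m₁ ∈ S, ∑ m₂ ∈ S, w m₁ * w m₂ * ((m₁.lcm m₂ : ℕ) : ℝ)⁻¹ +
        B ^ 2 * (∑ m ∈ S, w m) ^ 2 := by
  have e : ((∑ y ∈ Finset.range Y, ‖∑ m ∈ S, (w m : ℂ) * multExpSum z m B y‖ ^ 2 : ℝ) : ℂ) =
      ∑ m₁ ∈ S, ∑ m₂ ∈ S, ((w m₁ * w m₂ : ℝ) : ℂ) * ∑ y ∈ Finset.range Y,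
        multExpSum z m₁ B y * starRingEnd ℂ (multExpSum z m₂ B y) := by
    push_cast
    simp only [← Complex.mul_conj', map_sum, map_mul, Complex.conj_ofReal, Finset.sum_mul_sum]
    simp only [Finset.mul_sum]
    rw [Finset.sum_comm]
    refine Finset.sum_congr rfl fun m₁ _ => ?_
    rw [Finset.sum_comm]
    refine Finset.sum_congr rfl fun m₂ _ => Finset.sum_congr rfl fun y _ => by ring
  have hnn : 0 ≤ ∑ y ∈ Finset.range Y, ‖∑ m ∈ S, (w m : ℂ) * multExpSum z m B y‖ ^ 2 :=
    Finset.sum_nonneg fun y _ => by positivity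
  rw [← Complex.norm_of_nonneg hnn, e, sq (∑ m ∈ S, w m), Finset.sum_mul_sum, Finset.mul_sum,
    Finset.mul_sum, ← Finset.sum_add_distrib]
  refine (norm_sum_le _ _).trans (Finset.sum_le_sum fun m₁ hm₁ => ?_)
  rw [Finset.mul_sum, Finset.mul_sum, ← Finset.sum_add_distrib]
  refine (norm_sum_le _ _).trans (Finset.sum_le_sum fun m₂ hm₂ => ?_)
  have h0 := mul_nonneg (hw _ hm₁) (hw _ hm₂)
  rw [norm_mul, Complex.norm_of_nonneg h0]
  refine (mul_le_mul_of_nonneg_left (norm_sum_multExpSum_mul_conj_le hq hz (hS _ hm₁) (hS _ hm₂)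
    (hzS _ hm₁) B Y) h0).trans (le_of_eq ?_)
  ring

/-! ### From blocks to intervals. -/

/-- The incomplete last block is bounded by absolute values and then completed to length `B`, so
every error is attached to a full block. -/
lemma norm_sum_range_le_blocks (A : ℕ → ℂ) {B : ℕ} (hB : 0 < B) (N h : ℕ) :
    ‖∑ r ∈ Finset.range h, A (N + r)‖ ≤
      ∑ i ∈ Finset.range (h / B), ‖∑ r ∈ Finset.range B, A (N + i * B + r)‖ +
        ∑ r ∈ Finset.range B, ‖A (N + h / B * B + r)‖ := by
  have hk : ∀ k : ℕ, ∑ r ∈ Finset.range (k * B), A (N + r) =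
      ∑ i ∈ Finset.range k, ∑ r ∈ Finset.range B, A (N + i * B + r) := by
    intro k
    induction k with
    | zero => simp
    | succ k ih =>
      rw [Nat.succ_mul, Finset.sum_range_add, ih, Finset.sum_range_succ]
      simp only [add_assoc]
  conv_lhs => rw [← Nat.div_add_mod' h B, Finset.sum_range_add, hk]
  refine (norm_add_le _ _).trans (add_le_add (norm_sum_le _ _) ((norm_sum_le _ _).trans ?_))
  simp only [← add_assoc]
  exact Finset.sum_le_sum_of_subset_of_nonneg
    (Finset.range_mono (Nat.mod_lt h hB).le) fun _ _ _ => norm_nonneg _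

/-- The sum of `w m` over the divisors `m ∈ S` of `n`. -/
noncomputable def divisorSum (S : Finset ℕ) (w : ℕ → ℝ) (n : ℕ) : ℝ :=
  ∑ m ∈ S, if m ∣ n then w m else 0

/-- The deviation of the sum of `divisorSum S w` over `y, …, y + B - 1` from its mean. -/
noncomputable def divisorDev (S : Finset ℕ) (w : ℕ → ℝ) (B y : ℕ) : ℝ :=
  ∑ m ∈ S, w m * (multCount m B y - B / m)

lemma sum_divisorSum (S : Finset ℕ) (w : ℕ → ℝ) (B y : ℕ) :
    ∑ r ∈ Finset.range B, divisorSum S w (y + r) =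
      B * ∑ m ∈ S, w m / m + divisorDev S w B y := by
  rw [divisorDev, Finset.mul_sum, ← Finset.sum_add_distrib]
  simp only [divisorSum]
  rw [Finset.sum_comm]
  refine Finset.sum_congr rfl fun m _ => ?_
  rw [mul_sub, multCount, Finset.mul_sum]
  simp only [mul_ite, mul_one, mul_zero]
  ring

/-- The error terms in short intervals of a sum of divisor weights, both untwisted and twisted
by the powers of a `q`-th root of unity `z`. -/
noncomputable def divisorError (S : Finset ℕ) (w : ℕ → ℝ) (q : ℕ) (z : ℂ) (B y : ℕ) : ℝ :=
  |divisorDev S w B y| + |divisorDev (S.filter (q ∣ ·)) w B y| +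
    ‖∑ m ∈ S.filter (¬ q ∣ ·), (w m : ℂ) * multExpSum z m B y‖

lemma divisorError_nonneg (S : Finset ℕ) (w : ℕ → ℝ) (q : ℕ) (z : ℂ) (B y : ℕ) :
    0 ≤ divisorError S w q z B y := by
  unfold divisorError
  positivity

lemma divisorSum_nonneg {S : Finset ℕ} {w : ℕ → ℝ} (hw : ∀ m ∈ S, 0 ≤ w m) (n : ℕ) :
    0 ≤ divisorSum S w n :=
  Finset.sum_nonneg fun m hm => by split_ifs; exacts [hw m hm, le_rfl]

lemma sum_divisorSum_mul_pow {S : Finset ℕ} {w : ℕ → ℝ} {q : ℕ} {z : ℂ} (hz : z ^ q = 1)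
    (B y : ℕ) :
    ∑ r ∈ Finset.range B, (divisorSum S w (y + r) : ℂ) * z ^ (y + r) =
      ((B * ∑ m ∈ S.filter (q ∣ ·), w m / m + divisorDev (S.filter (q ∣ ·)) w B y : ℝ) : ℂ) +
      ∑ m ∈ S.filter (¬ q ∣ ·), (w m : ℂ) * multExpSum z m B y := by
  rw [← sum_divisorSum]
  simp only [divisorSum, Complex.ofReal_sum, Finset.sum_mul]
  rw [Finset.sum_comm, Finset.sum_comm (s := Finset.range B),
    ← Finset.sum_filter_add_sum_filter_not S (q ∣ ·)]
  congr 1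
  · refine Finset.sum_congr rfl fun m hm => Finset.sum_congr rfl fun r _ => ?_
    split_ifs with h
    · obtain ⟨c, hc⟩ := (Finset.mem_filter.1 hm).2.trans h
      rw [hc, pow_mul, hz, one_pow, mul_one]
    · simp
  · refine Finset.sum_congr rfl fun m _ => ?_
    rw [multExpSum, Finset.mul_sum]
    refine Finset.sum_congr rfl fun r _ => ?_
    split_ifs <;> simp

lemma norm_exp_two_pi_mul_I_sub_le (β : ℝ) (y r : ℕ) :
    ‖Complex.exp (2 * Real.pi * Complex.I * β * (y + r : ℕ)) -
      Complex.exp (2 * Real.pi * Complex.I * β * y)‖ ≤ 2 * Real.pi * |β| * r := by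
  have e1 : Complex.exp (2 * Real.pi * Complex.I * β * (y + r : ℕ)) =
      Complex.exp ((2 * Real.pi * β * y : ℝ) * Complex.I) *
        Complex.exp (Complex.I * (2 * Real.pi * β * r : ℝ)) := by
    rw [← Complex.exp_add]; congr 1; push_cast; ring
  have e2 : Complex.exp (2 * Real.pi * Complex.I * β * y) =
      Complex.exp ((2 * Real.pi * β * y : ℝ) * Complex.I) := by
    congr 1; push_cast; ring
  rw [e1, e2, ← mul_sub_one, norm_mul, Complex.norm_exp_ofReal_mul_I, one_mul]
  refine Real.norm_exp_I_mul_ofReal_sub_one_le.trans (le_of_eq ?_)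
  rw [Real.norm_eq_abs, abs_mul, abs_mul, abs_of_pos Real.two_pi_pos, Nat.abs_cast]

lemma norm_exp_two_pi_mul_I (β : ℝ) (n : ℕ) :
    ‖Complex.exp (2 * Real.pi * Complex.I * β * n)‖ = 1 := by
  rw [show 2 * Real.pi * Complex.I * β * n = (2 * Real.pi * β * n : ℝ) * Complex.I by
    push_cast; ring, Complex.norm_exp_ofReal_mul_I]

/-- Freeze the slow phase at the left end of the block; since the weights are nonnegative, the cost
is an untwisted sum of the same weights. -/
lemma norm_sum_block_le {S : Finset ℕ} {w : ℕ → ℝ} (hw : ∀ m ∈ S, 0 ≤ w m) {q : ℕ} {z : ℂ}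
    (hq : 0 < q) (hz : z ^ q = 1) (β : ℝ) (B y : ℕ) :
    ‖∑ r ∈ Finset.range B, (divisorSum S w (y + r) : ℂ) * z ^ (y + r) *
        Complex.exp (2 * Real.pi * Complex.I * β * (y + r : ℕ))‖ ≤
      ‖∑ r ∈ Finset.range B, (divisorSum S w (y + r) : ℂ) * z ^ (y + r)‖ +
        2 * Real.pi * |β| * B * ∑ r ∈ Finset.range B, divisorSum S w (y + r) := by
  have hn : ‖z‖ = 1 := Complex.norm_eq_one_of_pow_eq_one hz hq.ne'
  set E := Complex.exp (2 * Real.pi * Complex.I * β * y)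
  have e : ∑ r ∈ Finset.range B, (divisorSum S w (y + r) : ℂ) * z ^ (y + r) *
        Complex.exp (2 * Real.pi * Complex.I * β * (y + r : ℕ)) =
      (∑ r ∈ Finset.range B, (divisorSum S w (y + r) : ℂ) * z ^ (y + r)) * E +
      ∑ r ∈ Finset.range B, (divisorSum S w (y + r) : ℂ) * z ^ (y + r) *
        (Complex.exp (2 * Real.pi * Complex.I * β * (y + r : ℕ)) - E) := by
    rw [Finset.sum_mul, ← Finset.sum_add_distrib]
    exact Finset.sum_congr rfl fun r _ => by ring
  rw [e]
  refine (norm_add_le _ _).trans (add_le_add ?_ ?_)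
  · rw [norm_mul, norm_exp_two_pi_mul_I, mul_one]
  · rw [Finset.mul_sum]
    refine (norm_sum_le _ _).trans (Finset.sum_le_sum fun r hr => ?_)
    have h0 := divisorSum_nonneg hw (y + r)
    rw [norm_mul, norm_mul, norm_pow, hn, one_pow, mul_one, Complex.norm_of_nonneg h0, mul_comm]
    refine mul_le_mul_of_nonneg_right ((norm_exp_two_pi_mul_I_sub_le β y r).trans ?_) h0
    have : (r : ℝ) ≤ B := by exact_mod_cast (Finset.mem_range.1 hr).le
    have := Real.pi_pos
    gcongr

/-- Sums of divisor weights twisted by an additive character with frequency near a rational, over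
an interval tiled by short blocks. -/
lemma norm_sum_divisorSum_le {S : Finset ℕ} {w : ℕ → ℝ} (hw : ∀ m ∈ S, 0 ≤ w m) {q : ℕ} {z : ℂ}
    (hq : 0 < q) (hz : z ^ q = 1) {β η : ℝ} {B : ℕ} (hB : 0 < B) (hβ : |β| * B ≤ η) (hη : η ≤ 1)
    (N : ℕ) {h R : ℕ} (hR : h / B ≤ R) :
    ‖∑ r ∈ Finset.range h, (divisorSum S w (N + r) : ℂ) * z ^ (N + r) *
        Complex.exp (2 * Real.pi * Complex.I * β * (N + r : ℕ))‖ ≤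
      h * ∑ m ∈ S.filter (q ∣ ·), w m / m + 7 * η * h * ∑ m ∈ S, w m / m +
        B * ∑ m ∈ S, w m / m + 7 * ∑ i ∈ Finset.range (R + 1), divisorError S w q z B (N + i * B) := by
  have hn : ‖z‖ = 1 := Complex.norm_eq_one_of_pow_eq_one hz hq.ne'
  set c₀ := ∑ m ∈ S, w m / m
  set c₁ := ∑ m ∈ S.filter (q ∣ ·), w m / m
  have hc₀ : 0 ≤ c₀ := Finset.sum_nonneg fun m hm => div_nonneg (hw m hm) (by positivity)
  have hc₁ : 0 ≤ c₁ := Finset.sum_nonneg fun m hm =>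
    div_nonneg (hw m (Finset.mem_filter.1 hm).1) (by positivity)
  have hη0 : 0 ≤ η := le_trans (by positivity) hβ
  set U := divisorError S w q z B
  have hU0 : ∀ y, 0 ≤ U y := divisorError_nonneg S w q z B
  have hUdef : ∀ y, U y = |divisorDev S w B y| + |divisorDev (S.filter (q ∣ ·)) w B y| +
    ‖∑ m ∈ S.filter (¬ q ∣ ·), (w m : ℂ) * multExpSum z m B y‖ := fun _ => rfl
  have hblock : ∀ y, ‖∑ r ∈ Finset.range B, (divisorSum S w (y + r) : ℂ) * z ^ (y + r) *
        Complex.exp (2 * Real.pi * Complex.I * β * (y + r : ℕ))‖ ≤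
        c₁ * B + 7 * η * c₀ * B + 7 * U y := by
    intro y
    refine (norm_sum_block_le hw hq hz β B y).trans ?_
    rw [sum_divisorSum_mul_pow hz, sum_divisorSum, hUdef]
    have h1 : ‖((B * c₁ + divisorDev (S.filter (q ∣ ·)) w B y : ℝ) : ℂ) +
        ∑ m ∈ S.filter (¬ q ∣ ·), (w m : ℂ) * multExpSum z m B y‖ ≤
        B * c₁ + |divisorDev (S.filter (q ∣ ·)) w B y| +
          ‖∑ m ∈ S.filter (¬ q ∣ ·), (w m : ℂ) * multExpSum z m B y‖ := by
      refine (norm_add_le _ _).trans (add_le_add_left ?_ _)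
      rw [Complex.norm_real, Real.norm_eq_abs]
      refine (abs_add_le _ _).trans_eq ?_
      rw [abs_of_nonneg (by positivity)]
    -- The constant `7` is a round number above `2π`.
    have h2 : 2 * Real.pi * |β| * B ≤ 7 * η := by
      have := Real.pi_lt_d2
      have := Real.pi_pos
      have h3 : 0 ≤ |β| * B := by positivity
      nlinarith
    have h4 : B * c₀ + divisorDev S w B y ≤ B * c₀ + |divisorDev S w B y| := by
      linarith [le_abs_self (divisorDev S w B y)]
    have h5 : 2 * Real.pi * |β| * B * (B * c₀ + divisorDev S w B y) ≤
        7 * η * (B * c₀ + |divisorDev S w B y|) := by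
      have := Real.pi_pos
      exact (mul_le_mul_of_nonneg_left h4 (by positivity)).trans
        (mul_le_mul_of_nonneg_right h2 (by positivity))
    have h6 : η * |divisorDev S w B y| ≤ |divisorDev S w B y| :=
      mul_le_of_le_one_left (abs_nonneg _) hη
    have h7 := abs_nonneg (divisorDev (S.filter (q ∣ ·)) w B y)
    have h8 := norm_nonneg (∑ m ∈ S.filter (¬ q ∣ ·), (w m : ℂ) * multExpSum z m B y)
    linarith
  have hlast : ∀ y, ∑ r ∈ Finset.range B, ‖(divisorSum S w (y + r) : ℂ) * z ^ (y + r) *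
        Complex.exp (2 * Real.pi * Complex.I * β * (y + r : ℕ))‖ ≤ B * c₀ + 7 * U y := by
    intro y
    have : ∀ r ∈ Finset.range B, ‖(divisorSum S w (y + r) : ℂ) * z ^ (y + r) *
        Complex.exp (2 * Real.pi * Complex.I * β * (y + r : ℕ))‖ = divisorSum S w (y + r) := by
      intro r _
      rw [norm_mul, norm_mul, norm_pow, hn, one_pow, norm_exp_two_pi_mul_I, mul_one, mul_one,
        Complex.norm_of_nonneg (divisorSum_nonneg hw _)]
    rw [Finset.sum_congr rfl this, sum_divisorSum, hUdef]
    have h7 := abs_nonneg (divisorDev (S.filter (q ∣ ·)) w B y)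
    have h8 := norm_nonneg (∑ m ∈ S.filter (¬ q ∣ ·), (w m : ℂ) * multExpSum z m B y)
    have h9 := le_abs_self (divisorDev S w B y)
    have h10 := abs_nonneg (divisorDev S w B y)
    linarith
  refine (norm_sum_range_le_blocks (fun n => (divisorSum S w n : ℂ) * z ^ n *
    Complex.exp (2 * Real.pi * Complex.I * β * (n : ℕ))) hB N h).trans ?_
  refine (add_le_add (Finset.sum_le_sum fun i _ => hblock (N + i * B))
    (hlast (N + h / B * B))).trans ?_
  have hsum : ∑ i ∈ Finset.range (h / B), U (N + i * B) + U (N + h / B * B) ≤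
      ∑ i ∈ Finset.range (R + 1), U (N + i * B) := by
    rw [← Finset.sum_range_succ (fun i => U (N + i * B))]
    exact Finset.sum_le_sum_of_subset_of_nonneg (Finset.range_mono (by omega)) fun _ _ _ => hU0 _
  rw [Finset.sum_add_distrib, ← Finset.mul_sum]
  simp only [Finset.sum_const, Finset.card_range, nsmul_eq_mul]
  have hhB : ((h / B : ℕ) : ℝ) * B ≤ h := by exact_mod_cast Nat.div_mul_le_self h B
  have h11 : ((h / B : ℕ) : ℝ) * (c₁ * B + 7 * η * c₀ * B) ≤ h * (c₁ + 7 * η * c₀) := by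
    calc _ = ((h / B : ℕ) : ℝ) * B * (c₁ + 7 * η * c₀) := by ring
      _ ≤ _ := by gcongr
  nlinarith

/-! ### Moments of the errors, Markov's inequality and the cutoff. -/

/-- The second moment of the error terms. -/
lemma sum_divisorError_sq_le {S : Finset ℕ} (hS : ∀ m ∈ S, 0 < m) {w : ℕ → ℝ}
    (hw : ∀ m ∈ S, 0 ≤ w m) {q : ℕ} {z : ℂ} (hq : 0 < q) (hz : ∀ m : ℕ, z ^ m = 1 ↔ q ∣ m)
    (B Y : ℕ) :
    ∑ y ∈ Finset.range Y, divisorError S w q z B y ^ 2 ≤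
      9 * (Y * B * q * ∑ m₁ ∈ S, ∑ m₂ ∈ S, w m₁ * w m₂ * ((m₁.lcm m₂ : ℕ) : ℝ)⁻¹) +
        21 * (B ^ 2 * (∑ m ∈ S, w m) ^ 2) := by
  set Λ : Finset ℕ → ℝ := fun S =>
    ∑ m₁ ∈ S, ∑ m₂ ∈ S, w m₁ * w m₂ * ((m₁.lcm m₂ : ℕ) : ℝ)⁻¹
  have hΛ : ∀ T ⊆ S, 0 ≤ Λ T ∧ Λ T ≤ Λ S := by
    intro T hT
    have h0 : ∀ m₁ ∈ S, ∀ m₂ ∈ S, 0 ≤ w m₁ * w m₂ * ((m₁.lcm m₂ : ℕ) : ℝ)⁻¹ := fun m₁ h₁ m₂ h₂ =>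
      mul_nonneg (mul_nonneg (hw _ h₁) (hw _ h₂)) (by positivity)
    refine ⟨Finset.sum_nonneg fun m₁ h₁ => Finset.sum_nonneg fun m₂ h₂ =>
      h0 _ (hT h₁) _ (hT h₂), ?_⟩
    refine (Finset.sum_le_sum fun m₁ h₁ => Finset.sum_le_sum_of_subset_of_nonneg hT
      fun m₂ h₂ _ => h0 _ (hT h₁) _ h₂).trans ?_
    exact Finset.sum_le_sum_of_subset_of_nonneg hT fun m₁ h₁ _ =>
      Finset.sum_nonneg fun m₂ h₂ => h0 _ h₁ _ h₂
  have hW : ∀ T ⊆ S, (∑ m ∈ T, w m) ^ 2 ≤ (∑ m ∈ S, w m) ^ 2 := by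
    intro T hT
    exact pow_le_pow_left₀ (Finset.sum_nonneg fun m hm => hw _ (hT hm))
      (Finset.sum_le_sum_of_subset_of_nonneg hT fun m hm _ => hw _ hm) 2
  have hq1 : (1 : ℝ) ≤ q := by exact_mod_cast hq
  have hV : ∀ T ⊆ S, ∑ y ∈ Finset.range Y, divisorDev T w B y ^ 2 ≤
      Y * B * q * Λ S + 3 * (B ^ 2 * (∑ m ∈ S, w m) ^ 2) := by
    intro T hT
    refine (sum_sq_multCount_sub_le (fun m hm => hS _ (hT hm)) (fun m hm => hw _ (hT hm))
      B Y).trans ?_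
    have h1 : (Y : ℝ) * B * Λ T ≤ Y * B * q * Λ S := by
      have h2 : (Y : ℝ) * B * 1 ≤ Y * B * q := by gcongr
      rw [mul_one] at h2
      exact mul_le_mul h2 (hΛ T hT).2 (hΛ T hT).1 (by positivity)
    have h2 : (3 : ℝ) * B ^ 2 * (∑ m ∈ T, w m) ^ 2 ≤ 3 * B ^ 2 * (∑ m ∈ S, w m) ^ 2 :=
      mul_le_mul_of_nonneg_left (hW T hT) (by positivity)
    linarith
  have hT := sum_norm_sq_multExpSum_le (S := S.filter (¬ q ∣ ·)) hq ((hz q).2 dvd_rfl)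
    (fun m hm => hS _ (Finset.mem_filter.1 hm).1)
    (fun m hm h => (Finset.mem_filter.1 hm).2 ((hz m).1 h))
    (fun m hm => hw _ (Finset.mem_filter.1 hm).1) B Y
  have hT1 : (Y : ℝ) * B * q * Λ (S.filter (¬ q ∣ ·)) ≤ Y * B * q * Λ S :=
    mul_le_mul_of_nonneg_left (hΛ _ (Finset.filter_subset _ _)).2 (by positivity)
  have hT2 : (B : ℝ) ^ 2 * (∑ m ∈ S.filter (¬ q ∣ ·), w m) ^ 2 ≤ B ^ 2 * (∑ m ∈ S, w m) ^ 2 :=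
    mul_le_mul_of_nonneg_left (hW _ (Finset.filter_subset _ _)) (by positivity)
  have hV0 := hV S subset_rfl
  have hV1 := hV (S.filter (q ∣ ·)) (Finset.filter_subset _ _)
  calc ∑ y ∈ Finset.range Y, divisorError S w q z B y ^ 2
      ≤ ∑ y ∈ Finset.range Y, 3 * (divisorDev S w B y ^ 2 +
          divisorDev (S.filter (q ∣ ·)) w B y ^ 2 +
          ‖∑ m ∈ S.filter (¬ q ∣ ·), (w m : ℂ) * multExpSum z m B y‖ ^ 2) := by
        refine Finset.sum_le_sum fun y _ => ?_
        rw [← sq_abs (divisorDev S w B y), ← sq_abs (divisorDev (S.filter (q ∣ ·)) w B y),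
          divisorError]
        nlinarith [sq_nonneg (|divisorDev S w B y| - |divisorDev (S.filter (q ∣ ·)) w B y|),
          sq_nonneg (|divisorDev S w B y| -
            ‖∑ m ∈ S.filter (¬ q ∣ ·), (w m : ℂ) * multExpSum z m B y‖),
          sq_nonneg (|divisorDev (S.filter (q ∣ ·)) w B y| -
            ‖∑ m ∈ S.filter (¬ q ∣ ·), (w m : ℂ) * multExpSum z m B y‖)]
    _ ≤ _ := by
        rw [← Finset.mul_sum, Finset.sum_add_distrib, Finset.sum_add_distrib]
        linarith

/-- Markov's inequality for functions that factor through the ceiling. -/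
lemma volume_setOf_lt_ceil_le {g : ℕ → ℝ} (hg : ∀ n, 0 ≤ g n) {τ : ℝ} (hτ : 0 < τ) {u v : ℝ}
    (hu : 0 ≤ u) {Y : ℕ} (hY : ⌈v⌉₊ < Y) :
    volume {x ∈ Set.Icc u v | τ < g ⌈x⌉₊} ≤
      ENNReal.ofReal ((∑ n ∈ Finset.range Y, g n) / τ) := by
  classical
  set T := (Finset.range Y).filter fun n => τ < g n
  have hsub : {x ∈ Set.Icc u v | τ < g ⌈x⌉₊} ⊆ ⋃ n ∈ T, Set.Ioc ((n : ℝ) - 1) n := by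
    rintro x ⟨hx, hxg⟩
    simp only [Set.mem_iUnion, exists_prop]
    refine ⟨⌈x⌉₊, Finset.mem_filter.2
      ⟨Finset.mem_range.2 ((Nat.ceil_mono hx.2).trans_lt hY), hxg⟩, ?_, Nat.le_ceil x⟩
    linarith [Nat.ceil_lt_add_one (hu.trans hx.1)]
  calc _ ≤ volume (⋃ n ∈ T, Set.Ioc ((n : ℝ) - 1) n) := measure_mono hsub
    _ ≤ ∑ n ∈ T, volume (Set.Ioc ((n : ℝ) - 1) n) := measure_biUnion_finset_le _ _
    _ = ENNReal.ofReal T.card := by simp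
    _ ≤ _ := by
        refine ENNReal.ofReal_le_ofReal ?_
        rw [le_div_iff₀ hτ]
        calc (T.card : ℝ) * τ = ∑ _n ∈ T, τ := by simp
          _ ≤ ∑ n ∈ T, g n := Finset.sum_le_sum fun n hn => (Finset.mem_filter.1 hn).2.le
          _ ≤ _ := Finset.sum_le_sum_of_subset_of_nonneg (Finset.filter_subset _ _)
              fun n _ _ => hg n

lemma sum_shift_le {U : ℕ → ℝ} (hU : ∀ n, 0 ≤ U n) (B R Y : ℕ) :
    ∑ N ∈ Finset.range Y, ∑ i ∈ Finset.range (R + 1), U (N + i * B) ≤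
      (R + 1) * ∑ y ∈ Finset.range (Y + R * B), U y := by
  rw [Finset.sum_comm]
  refine (Finset.sum_le_sum (g := fun _ => ∑ y ∈ Finset.range (Y + R * B), U y)
    fun i hi => ?_).trans (by simp)
  have hi' : i * B ≤ R * B := Nat.mul_le_mul_right B (Nat.lt_succ_iff.1 (Finset.mem_range.1 hi))
  rw [← Finset.sum_image (s := Finset.range Y) (g := fun N => N + i * B) (f := U)
    (fun a _ b _ h => by simpa using h)]
  refine Finset.sum_le_sum_of_subset_of_nonneg ?_ fun _ _ _ => hU _
  intro n hn
  obtain ⟨N, hN, rfl⟩ := Finset.mem_image.1 hn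
  have := Finset.mem_range.1 hN
  exact Finset.mem_range.2 (by omega)

/-- A sum over an interval cut off to `(X, 2X]` is bounded through the sums over the intervals
with the same left end. -/
lemma norm_sum_Icc_cutoff_le (A : ℕ → ℂ) {X x H : ℝ} (hX : 0 ≤ X) (hx : 0 ≤ x) (hH : 0 ≤ H) {b : ℝ}
    (hb : ∀ h : ℕ, (h : ℝ) ≤ H + 1 → ‖∑ r ∈ Finset.range h, A (⌈x⌉₊ + r)‖ ≤ b) :
    ‖∑ n ∈ Finset.Icc ⌈x⌉₊ ⌊x + H⌋₊, if X < n ∧ (n : ℝ) ≤ 2 * X then A n else 0‖ ≤ 2 * b := by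
  set N := ⌈x⌉₊
  set P := min (⌊x + H⌋₊ + 1) (⌊2 * X⌋₊ + 1) with hP
  have hle : ∀ e ≤ P, ‖∑ n ∈ Finset.Ico N e, A n‖ ≤ b := by
    intro e he
    rw [Finset.sum_Ico_eq_sum_range]
    refine hb _ ?_
    rcases le_total e N with h | h
    · rw [Nat.sub_eq_zero_of_le h]; push_cast; linarith
    · rw [Nat.cast_sub h]
      have h1 : (e : ℝ) ≤ ⌊x + H⌋₊ + 1 := by exact_mod_cast he.trans (min_le_left _ _)
      have h2 : (⌊x + H⌋₊ : ℝ) ≤ x + H := Nat.floor_le (by positivity)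
      have h3 : x ≤ N := Nat.le_ceil x
      linarith
  have e : (Finset.Icc N ⌊x + H⌋₊).filter (fun n : ℕ => X < n ∧ (n : ℝ) ≤ 2 * X) =
      Finset.Ico N P \ Finset.Ico N (min P (⌊X⌋₊ + 1)) := by
    ext n
    have h1 : X < n ↔ ⌊X⌋₊ < n := (Nat.floor_lt hX).symm
    have h2 : (n : ℝ) ≤ 2 * X ↔ n ≤ ⌊2 * X⌋₊ := (Nat.le_floor_iff (by positivity)).symm
    simp only [Finset.mem_filter, Finset.mem_Icc, Finset.mem_sdiff, Finset.mem_Ico, h1, h2, hP,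
      lt_min_iff]
    omega
  rw [← Finset.sum_filter, e, Finset.sum_sdiff_eq_sub
    (Finset.Ico_subset_Ico_right (min_le_left _ _))]
  refine (norm_sub_le _ _).trans ?_
  linarith [hle P le_rfl, hle _ (min_le_left P (⌊X⌋₊ + 1))]

/-! ### The moduli and their weights. -/

/-- `M = X ^ o(1)`, and powers of `log X` are also `X ^ o(1)`. -/
lemma eventually_rpow_log_mul_levelM_sq_le (k A : ℝ) :
    ∀ᶠ X : ℝ in atTop, Real.log X ^ A * levelM k X ^ 2 ≤ X := by
  have hLL : Tendsto (fun X : ℝ => Real.log (Real.log X)) atTop atTop :=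
    Real.tendsto_log_atTop.comp Real.tendsto_log_atTop
  have h1 : Tendsto (fun X : ℝ => A * (Real.log (Real.log X) / Real.log X) +
      4 * k * (Real.log (Real.log X))⁻¹) atTop (𝓝 (A * 0 + 4 * k * 0)) := by
    refine (Tendsto.const_mul A ?_).add (hLL.inv_tendsto_atTop.const_mul (4 * k))
    exact (Real.isLittleO_log_id_atTop.tendsto_div_nhds_zero).comp Real.tendsto_log_atTop
  rw [mul_zero, mul_zero, add_zero] at h1
  filter_upwards [h1.eventually_lt_const one_pos, Real.tendsto_log_atTop.eventually_gt_atTop 0,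
    hLL.eventually_gt_atTop 0, eventually_gt_atTop 0] with X hX hL hL2 hX0
  have e : Real.log X ^ A * levelM k X ^ 2 =
      Real.exp (Real.log X * (A * (Real.log (Real.log X) / Real.log X) +
        4 * k * (Real.log (Real.log X))⁻¹)) := by
    rw [levelM, Real.rpow_def_of_pos hL, Real.rpow_def_of_pos hX0, ← Real.exp_nat_mul,
      ← Real.exp_add]
    congr 1
    field_simp
    push_cast
    ring
  rw [e]
  calc _ ≤ Real.exp (Real.log X * 1) := by gcongr
    _ = X := by rw [mul_one, Real.exp_log hX0]

open Classical in
/-- The moduli `m` over which the sum defining `divisorTilde` runs. -/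
noncomputable def tildeModuli (ε' k X : ℝ) : Finset ℕ :=
  (Finset.Icc 1 ⌊levelM k X⌋₊).filter fun m =>
    (ArithmeticFunction.cardFactors m : ℝ) ≤ (1 + ε') * k * Real.log (Real.log X)

lemma divisorTilde_eq (ε' k X : ℝ) (hX : 0 ≤ X) (n : ℕ) :
    divisorTilde ε' k X n = if X < n ∧ (n : ℝ) ≤ 2 * X then
      divisorSum (tildeModuli ε' k X) (divisorFn (k - 1)) n else 0 := by
  classical
  unfold divisorTilde
  by_cases h : X < n ∧ (n : ℝ) ≤ 2 * X
  · rw [if_pos h, if_pos h, divisorSum, ← Finset.sum_filter]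
    refine Finset.sum_congr ?_ fun _ _ => rfl
    have hn : n ≠ 0 := by
      rintro rfl
      have := h.1
      push_cast at this
      linarith
    have hM : 0 ≤ levelM k X := Real.rpow_nonneg hX _
    ext m
    simp only [tildeModuli, Finset.mem_filter, Nat.mem_divisors, Finset.mem_Icc,
      Nat.le_floor_iff hM]
    constructor
    · rintro ⟨⟨h1, -⟩, h2, h3⟩
      exact ⟨⟨⟨Nat.pos_of_dvd_of_pos h1 (Nat.pos_of_ne_zero hn), h2⟩, h3⟩, h1⟩
    · rintro ⟨⟨⟨_, h2⟩, h3⟩, h1⟩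
      exact ⟨⟨h1, hn⟩, h2, h3⟩
  · rw [if_neg h, if_neg h]

/-- Put `m = q n` and use `d(q n) ≤ d(q) d(n)`. -/
lemma sum_divisorFn_div_dvd_le {κ : ℝ} (hκ : 1 ≤ κ) {S : Finset ℕ} {N q : ℕ} (hq : 0 < q)
    (hS : S ⊆ Finset.Icc 1 N) :
    ∑ m ∈ S.filter (q ∣ ·), divisorFn κ m / m ≤
      divisorFn κ q / q * ∑ m ∈ Finset.Icc 1 N, divisorFn κ m / m := by
  have hd : ∀ n, 0 ≤ divisorFn κ n := fun n => zero_le_one.trans (one_le_divisorFn hκ n)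
  have hmem : ∀ m ∈ S.filter (q ∣ ·), 1 ≤ m ∧ m ≤ N ∧ q * (m / q) = m ∧ 0 < m / q := by
    intro m hm
    obtain ⟨h1, h2⟩ := Finset.mem_filter.1 hm
    obtain ⟨h3, h4⟩ := Finset.mem_Icc.1 (hS h1)
    exact ⟨h3, h4, Nat.mul_div_cancel' h2, Nat.div_pos (Nat.le_of_dvd h3 h2) hq⟩
  have hinj : Set.InjOn (fun m => m / q) (S.filter (q ∣ ·) : Finset ℕ) := by
    intro a ha b hb h
    rw [← (hmem a ha).2.2.1, ← (hmem b hb).2.2.1]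
    exact congrArg (q * ·) h
  calc ∑ m ∈ S.filter (q ∣ ·), divisorFn κ m / m
      ≤ ∑ m ∈ S.filter (q ∣ ·),
          divisorFn κ q / q * (divisorFn κ (m / q : ℕ) / (m / q : ℕ)) := by
        refine Finset.sum_le_sum fun m hm => ?_
        obtain ⟨_, _, h3, h4⟩ := hmem m hm
        have h5 := divisorFn_mul_le hκ hq.ne' h4.ne'
        rw [h3] at h5
        rw [div_mul_div_comm, ← Nat.cast_mul, h3]
        gcongr
    _ = divisorFn κ q / q * ∑ m ∈ (S.filter (q ∣ ·)).image (fun m => m / q),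
          divisorFn κ m / m := by
        rw [Finset.sum_image hinj, Finset.mul_sum]
    _ ≤ _ := by
        refine mul_le_mul_of_nonneg_left ?_ (div_nonneg (hd _) (by positivity))
        refine Finset.sum_le_sum_of_subset_of_nonneg ?_ fun m _ _ =>
          div_nonneg (hd _) (by positivity)
        intro n hn
        obtain ⟨m, hm, rfl⟩ := Finset.mem_image.1 hn
        obtain ⟨_, h2, _, h4⟩ := hmem m hm
        exact Finset.mem_Icc.2 ⟨h4, (Nat.div_le_self _ _).trans h2⟩

/-! ### Frequencies on the circle. -/

lemma exists_eq_add_coe_of_norm_sub_lt {α : UnitAddCircle} {t b : ℝ}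
    (h : ‖α - (t : UnitAddCircle)‖ < b) :
    ∃ β : ℝ, α = ((t + β : ℝ) : UnitAddCircle) ∧ |β| < b := by
  obtain ⟨γ, hγ⟩ : ∃ γ : ℝ, (γ : UnitAddCircle) = α - (t : UnitAddCircle) :=
    QuotientAddGroup.mk_surjective _
  refine ⟨γ - round γ, ?_, ?_⟩
  · have h1 : (((round γ : ℤ) : ℝ) : UnitAddCircle) = 0 := by
      rw [AddCircle.coe_eq_zero_iff]
      exact ⟨round γ, by simp⟩
    rw [AddCircle.coe_add, AddCircle.coe_sub, h1, sub_zero, hγ]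
    abel
  · rwa [← hγ, UnitAddCircle.norm_eq] at h

lemma fourier_natCast_div_add (a : ℤ) (q : ℕ) (β : ℝ) (n : ℕ) :
    fourier (n : ℤ) (((a : ℝ) / q + β : ℝ) : UnitAddCircle) =
      Complex.exp (2 * Real.pi * Complex.I / q * a) ^ n *
        Complex.exp (2 * Real.pi * Complex.I * β * n) := by
  rw [fourier_coe_apply, ← Complex.exp_nat_mul, ← Complex.exp_add]
  congr 1
  push_cast
  ring

lemma exp_two_pi_mul_I_div_mul_pow_eq_one_iff {a : ℤ} {q : ℕ} (hq : 0 < q)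
    (h : IsCoprime a (q : ℤ)) (m : ℕ) :
    Complex.exp (2 * Real.pi * Complex.I / q * a) ^ m = 1 ↔ q ∣ m := by
  have h1 := Complex.isPrimitiveRoot_exp q hq.ne'
  have h2 := h1.zpow_of_gcd_eq_one a (Int.isCoprime_iff_gcd_eq_one.1 h)
  rw [← Complex.exp_int_mul, mul_comm] at h2
  exact h2.pow_eq_one_iff_dvd m

lemma measurableSet_setOf_lt_ceil (g : ℕ → ℝ) (τ u v : ℝ) :
    MeasurableSet {x : ℝ | x ∈ Set.Icc u v ∧ τ < g ⌈x⌉₊} := by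
  have h : Measurable fun x : ℝ => g ⌈x⌉₊ := (measurable_from_nat (f := g)).comp Nat.measurable_ceil
  exact measurableSet_Icc.inter (measurableSet_lt measurable_const h)

/-! ### Construction of the exceptional set. -/

set_option maxHeartbeats 1000000 in
/-- Divisor sums twisted by an additive character with frequency near a rational of denominator
`q` are small in almost all short intervals. In the application `Z = Q₁ ^ (1/8)`,
`G = (log X) ^ (k log k)` and `κ = k - 1`. -/
theorem exists_exceptional_set {S : Finset ℕ} {N : ℕ} (hSN : S ⊆ Finset.Icc 1 N) {κ : ℝ}
    (hκ : 1 ≤ κ) {X H Z G c K : ℝ} (hX : 3 ≤ X) (hHX : H ≤ X) (hK : 1 ≤ K)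
    (hG : 1 ≤ G) (hGZ : G ≤ Z ^ 3) (hZ : 1 ≤ Z) (hZH : Z ^ 24 ≤ H)
    (hc : ∑ m ∈ Finset.Icc 1 N, divisorFn κ m / m ≤ c) (hc1 : 1 ≤ c)
    (hΛ : ∑ m₁ ∈ S, ∑ m₂ ∈ S, divisorFn κ m₁ * divisorFn κ m₂ * ((m₁.lcm m₂ : ℕ) : ℝ)⁻¹ ≤
      K * G ^ 7)
    (hW : Z ^ 15 * (∑ m ∈ S, divisorFn κ m) ^ 2 ≤ X * G ^ 7)
    {q : ℕ} {z : ℂ} {β D : ℝ} (hq : 0 < q) (hqZ : (q : ℝ) ≤ Z ^ 8)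
    (hz : ∀ m : ℕ, z ^ m = 1 ↔ q ∣ m) (hβ : |β| ≤ 1 / (q * Z ^ 8)) (hD : divisorFn κ q ≤ D) :
    ∃ E ⊆ Set.Icc (X / 2) (2 * X), MeasurableSet E ∧
      volume E ≤ ENNReal.ofReal (720 * K * (X * G ^ 3 / Z)) ∧
      ∀ x ∈ Set.Icc (X / 2) (2 * X) \ E, ∀ h : ℕ, (h : ℝ) ≤ H + 1 →
        ‖∑ r ∈ Finset.range h, (divisorSum S (divisorFn κ) (⌈x⌉₊ + r) : ℂ) * z ^ (⌈x⌉₊ + r) *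
          Complex.exp (2 * Real.pi * Complex.I * β * (⌈x⌉₊ + r : ℕ))‖ ≤
        24 * ((1 / q + 1 / Z) * H * (c * D)) := by
  have hd0 : ∀ m, 0 ≤ divisorFn κ m := fun m => zero_le_one.trans (one_le_divisorFn hκ m)
  have hS0 : ∀ m ∈ S, 0 < m := fun m hm => (Finset.mem_Icc.1 (hSN hm)).1
  have hw : ∀ m ∈ S, 0 ≤ divisorFn κ m := fun m _ => hd0 m
  have hZ0 : 0 < Z := by linarith
  have hX0 : 0 < X := by linarith
  have hq1 : (1 : ℝ) ≤ q := by exact_mod_cast hq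
  have hH1 : 1 ≤ H := (one_le_pow₀ hZ).trans hZH
  have hqZ7 : 1 ≤ q * Z ^ 7 := one_le_mul_of_one_le_of_one_le hq1 (one_le_pow₀ hZ)
  -- Short enough that `|β| * B ≤ 1 / Z`, long enough that the factor `q` lost in the second moment
  -- is at most `2 * B / Z ^ 7`.
  set B := ⌊q * Z ^ 7⌋₊ with hBdef
  have hB0 : 0 < B := Nat.floor_pos.2 hqZ7
  have hB1 : (1 : ℝ) ≤ B := by exact_mod_cast hB0
  have hBle : (B : ℝ) ≤ q * Z ^ 7 := Nat.floor_le (by positivity)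
  have hBge : q * Z ^ 7 ≤ 2 * B := by
    have := Nat.lt_floor_add_one (q * Z ^ 7)
    linarith
  have hB15 : (B : ℝ) ≤ Z ^ 15 := hBle.trans (by
    calc (q : ℝ) * Z ^ 7 ≤ Z ^ 8 * Z ^ 7 := by gcongr
      _ = Z ^ 15 := by ring)
  have hBH : (B : ℝ) ≤ H / Z := by
    rw [le_div_iff₀ hZ0]
    calc (B : ℝ) * Z ≤ Z ^ 15 * Z := by gcongr
      _ = Z ^ 16 := by ring
      _ ≤ Z ^ 24 := pow_le_pow_right₀ hZ (by norm_num)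
      _ ≤ H := hZH
  have hBH' : (B : ℝ) ≤ H := hBH.trans (div_le_self (by linarith) hZ)
  set R := ⌊H + 1⌋₊ / B with hRdef
  have hRB : (R : ℝ) * B ≤ H + 1 := by
    have h1 : R * B ≤ ⌊H + 1⌋₊ := Nat.div_mul_le_self _ _
    calc (R : ℝ) * B ≤ ⌊H + 1⌋₊ := by exact_mod_cast h1
      _ ≤ H + 1 := Nat.floor_le (by linarith)
  set U := divisorError S (divisorFn κ) q z B
  have hU0 : ∀ y, 0 ≤ U y := divisorError_nonneg _ _ _ _ _
  -- `Y₀` covers every starting point `⌈x⌉₊`; `Y` adds room for the shifts by up to `R` blocks.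
  set Y₀ := ⌈2 * X⌉₊ + 1
  set Y := Y₀ + R * B with hY
  have hYX : (Y : ℝ) ≤ 4 * X := by
    have h1 := Nat.ceil_lt_add_one (show 0 ≤ 2 * X by linarith)
    simp only [hY, Y₀]
    push_cast
    linarith
  have hXY : X ≤ Y := by
    have h1 := Nat.le_ceil (2 * X)
    have h2 : (0 : ℝ) ≤ R * B := by positivity
    simp only [hY, Y₀]
    push_cast
    linarith
  have hUsq : ∑ y ∈ Finset.range Y, U y ^ 2 ≤ 30 * (Y * B * q * (K * G ^ 7)) := by
    refine (sum_divisorError_sq_le hS0 hw hq hz B Y).trans ?_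
    have h1 := mul_le_mul_of_nonneg_left hΛ (show (0 : ℝ) ≤ Y * B * q by positivity)
    have h2 : (B : ℝ) ^ 2 * (∑ m ∈ S, divisorFn κ m) ^ 2 ≤ Y * B * q * (K * G ^ 7) := by
      calc (B : ℝ) ^ 2 * (∑ m ∈ S, divisorFn κ m) ^ 2
          = B * (B * (∑ m ∈ S, divisorFn κ m) ^ 2) := by ring
        _ ≤ B * (Z ^ 15 * (∑ m ∈ S, divisorFn κ m) ^ 2) := by gcongr
        _ ≤ B * (X * G ^ 7) := by gcongr
        _ ≤ B * (Y * G ^ 7) := by gcongr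
        _ = Y * B * 1 * (1 * G ^ 7) := by ring
        _ ≤ _ := by gcongr
    linarith
  have hUsum : ∑ y ∈ Finset.range Y, U y ≤ 60 * K * (Y * B * G ^ 3 / Z ^ 2) := by
    refine le_of_sq_le_sq ?_ (by positivity)
    have h1 := sq_sum_le_card_mul_sum_sq (s := Finset.range Y) (f := U)
    rw [Finset.card_range] at h1
    have h2 : (q : ℝ) ≤ 2 * B / Z ^ 7 := by rwa [le_div_iff₀ (by positivity)]
    calc _ ≤ (Y : ℝ) * ∑ y ∈ Finset.range Y, U y ^ 2 := h1
      _ ≤ Y * (30 * (Y * B * (2 * B / Z ^ 7) * (K * G ^ 7))) := by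
        refine mul_le_mul_of_nonneg_left (hUsq.trans ?_) (by positivity)
        gcongr
      -- Of the saving `Z ^ 7`, a factor `Z ^ 3` cancels one `G`, and the remaining `Z ^ 4` gives `Z
      -- ^ 2` after the square root.
      _ = 60 * K * (Y * B) ^ 2 * G ^ 6 * (G / Z ^ 3) / Z ^ 4 := by
        field_simp
        ring
      _ ≤ 60 * K * (Y * B) ^ 2 * G ^ 6 * 1 / Z ^ 4 := by
        gcongr
        rw [div_le_one (by positivity)]
        exact hGZ
      _ ≤ (60 * K) ^ 2 * (Y * B) ^ 2 * G ^ 6 * 1 / Z ^ 4 := by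
        gcongr
        nlinarith
      _ = _ := by
        field_simp
  have hτ : 0 < H / Z := by positivity
  -- This total over all `R + 1` blocks dominates the error for every `h ≤ H + 1` at once. Markov at
  -- level `H / Z` spends one of the two saved factors `Z`.
  set g : ℕ → ℝ := fun n => ∑ i ∈ Finset.range (R + 1), U (n + i * B) with hg
  have hg0 : ∀ n, 0 ≤ g n := fun n => Finset.sum_nonneg fun i _ => hU0 _
  have hX2 : 0 ≤ X / 2 := by linarith
  have hY₀ : ⌈2 * X⌉₊ < Y₀ := Nat.lt_succ_self _
  have hgsum : ∑ n ∈ Finset.range Y₀, g n ≤ (R + 1) * ∑ y ∈ Finset.range Y, U y :=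
    sum_shift_le hU0 B R Y₀
  refine ⟨{x ∈ Set.Icc (X / 2) (2 * X) | H / Z < g ⌈x⌉₊}, Set.sep_subset _ _, ?_, ?_, ?_⟩
  · exact measurableSet_setOf_lt_ceil g _ _ _
  · refine (volume_setOf_lt_ceil_le (g := g) hg0 hτ hX2 hY₀).trans (ENNReal.ofReal_le_ofReal ?_)
    have hR1 : ((R : ℝ) + 1) ≤ 3 * H / B := by
      rw [le_div_iff₀ (by positivity)]
      linarith
    rw [div_le_iff₀ hτ]
    calc ∑ n ∈ Finset.range Y₀, g n ≤ (R + 1) * ∑ y ∈ Finset.range Y, U y := hgsum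
      _ ≤ 3 * H / B * (60 * K * (4 * X * B * G ^ 3 / Z ^ 2)) := by
        refine mul_le_mul hR1 (hUsum.trans ?_) (Finset.sum_nonneg fun y _ => hU0 y)
          (by positivity)
        gcongr
      _ = _ := by
        field_simp
        ring
  · rintro x ⟨hx, hxE⟩ h hh
    have hgx : g ⌈x⌉₊ ≤ H / Z := not_lt.1 fun hlt => hxE ⟨hx, hlt⟩
    have hhR : h / B ≤ R := Nat.div_le_div_right (Nat.le_floor hh)
    have hβB : |β| * B ≤ 1 / Z := by
      calc |β| * B ≤ 1 / (q * Z ^ 8) * (q * Z ^ 7) := by gcongr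
        _ = 1 / Z := by field_simp
    have hη : 1 / Z ≤ 1 := by rw [div_le_one hZ0]; exact hZ
    refine (norm_sum_divisorSum_le hw hq ((hz q).2 dvd_rfl) hB0 hβB hη ⌈x⌉₊ hhR).trans ?_
    have hn0 : ∀ T : Finset ℕ, 0 ≤ ∑ m ∈ T, divisorFn κ m / m := fun T =>
      Finset.sum_nonneg fun m _ => div_nonneg (hd0 m) (by positivity)
    have hc0 : ∑ m ∈ S, divisorFn κ m / m ≤ c := le_trans
      (Finset.sum_le_sum_of_subset_of_nonneg hSN fun m _ _ => div_nonneg (hd0 m) (by positivity)) hc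
    have hD1 : 1 ≤ D := (one_le_divisorFn hκ q).trans hD
    have hcD : ∑ m ∈ S, divisorFn κ m / m ≤ c * D :=
      hc0.trans (le_mul_of_one_le_right (by linarith) hD1)
    have hc1' : ∑ m ∈ S.filter (q ∣ ·), divisorFn κ m / m ≤ D / q * c :=
      (sum_divisorFn_div_dvd_le hκ hq hSN).trans (mul_le_mul (by gcongr) hc (hn0 _) (by positivity))
    have hh2 : (h : ℝ) ≤ 2 * H := by linarith
    have t1 : (h : ℝ) * ∑ m ∈ S.filter (q ∣ ·), divisorFn κ m / m ≤ 2 * H * (D / q * c) :=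
      mul_le_mul hh2 hc1' (hn0 _) (by positivity)
    have t2 : 7 * (1 / Z) * (h : ℝ) * ∑ m ∈ S, divisorFn κ m / m ≤
        7 * (1 / Z) * (2 * H) * (c * D) :=
      mul_le_mul (by gcongr) hcD (hn0 _) (by positivity)
    have t3 : (B : ℝ) * ∑ m ∈ S, divisorFn κ m / m ≤ H / Z * (c * D) :=
      mul_le_mul hBH hcD (hn0 _) (by positivity)
    have t4 : 7 * g ⌈x⌉₊ ≤ 7 * (H / Z) * (c * D) := by
      have : 1 ≤ c * D := one_le_mul_of_one_le_of_one_le hc1 hD1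
      calc 7 * g ⌈x⌉₊ ≤ 7 * (H / Z) := by gcongr
        _ ≤ _ := le_mul_of_one_le_right (by positivity) this
    have t5 : 0 ≤ H * (c * D) / Z := by positivity
    have t6 : 0 ≤ H * (c * D) / q := by positivity
    calc _ ≤ 2 * H * (D / q * c) + 7 * (1 / Z) * (2 * H) * (c * D) + H / Z * (c * D) +
          7 * (H / Z) * (c * D) := by linarith
      _ = 2 * (H * (c * D) / q) + 22 * (H * (c * D) / Z) := by ring
      _ ≤ 24 * (H * (c * D) / q) + 24 * (H * (c * D) / Z) := by linarith
      _ = _ := by ring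

/-! ### Choice of parameters and conclusion. -/

/-- Here `d_{k-1}(m) ≤ k ^ Ω(m)` and `Ω(m) ≤ 2k log log X`; this is where the restriction on `Ω`
enters. -/
lemma divisorFn_le_of_mem_tildeModuli {ε' k X : ℝ} (hk : 2 ≤ k) (hε' : ε' < 1)
    (hX : 0 ≤ Real.log (Real.log X)) (hL : 0 < Real.log X) {m : ℕ} (hm : m ∈ tildeModuli ε' k X) :
    divisorFn (k - 1) m ≤ (Real.log X ^ (k * Real.log k)) ^ 2 := by
  have h1 := (Finset.mem_filter.1 hm).2
  have hlogk : 0 ≤ Real.log k := Real.log_nonneg (by linarith)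
  refine (divisorFn_le_pow_cardFactors (by linarith) m).trans ?_
  refine (pow_le_pow_left₀ (by linarith) (show k - 1 ≤ k by linarith) _).trans ?_
  rw [← Real.rpow_natCast, ← Real.rpow_natCast, Real.rpow_def_of_pos (by linarith),
    ← Real.rpow_mul hL.le, Real.rpow_def_of_pos hL, Real.exp_le_exp]
  have h2 : (1 + ε') * k * Real.log (Real.log X) ≤ 2 * k * Real.log (Real.log X) := by
    have : 0 ≤ k * Real.log (Real.log X) := mul_nonneg (by linarith) hX
    nlinarith
  have h3 := mul_le_mul_of_nonneg_left (h1.trans h2) hlogk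
  push_cast
  linarith

lemma sum_mul_inv_lcm_le {w : ℕ → ℝ} {S : Finset ℕ} {N : ℕ} (hS : S ⊆ Finset.Icc 1 N) {b : ℝ}
    (hw0 : ∀ m ∈ S, 0 ≤ w m) (hw : ∀ m ∈ S, w m ≤ b) :
    ∑ m₁ ∈ S, ∑ m₂ ∈ S, w m₁ * w m₂ * ((m₁.lcm m₂ : ℕ) : ℝ)⁻¹ ≤
      b ^ 2 * (∑ m ∈ Finset.Icc 1 N, (m : ℝ)⁻¹) ^ 3 := by
  refine le_trans ?_ (mul_le_mul_of_nonneg_left (sum_inv_lcm_le N) (sq_nonneg b))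
  rw [Finset.mul_sum]
  refine (Finset.sum_le_sum fun m₁ h₁ => ?_).trans
    (Finset.sum_le_sum_of_subset_of_nonneg hS fun m₁ _ _ =>
      mul_nonneg (sq_nonneg b) (Finset.sum_nonneg fun m₂ _ => by positivity))
  rw [Finset.mul_sum]
  refine (Finset.sum_le_sum fun m₂ h₂ => ?_).trans
    (Finset.sum_le_sum_of_subset_of_nonneg hS fun m₂ _ _ => by positivity)
  refine mul_le_mul_of_nonneg_right ?_ (by positivity)
  rw [sq]
  exact mul_le_mul (hw _ h₁) (hw _ h₂) (hw0 _ h₂) ((hw0 _ h₁).trans (hw _ h₁))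

lemma one_le_mul_log {k : ℝ} (hk : 2 ≤ k) : 1 ≤ k * Real.log k := by
  have h1 : Real.log 2 ≤ Real.log k := Real.log_le_log (by norm_num) hk
  have h2 := Real.log_two_gt_d9
  nlinarith

set_option maxHeartbeats 1000000 in
theorem mainTheorem4 (k : ℝ) (hk : 2 ≤ k) (ε' : ℝ) (hε'_pos : 0 < ε') (hε'_lt : ε' < 1) :
    ∃ (C : ℝ) (δ : ℝ → ℝ), 0 < C ∧ Tendsto δ atTop (𝓝 0) ∧
      ∀ (X H₁ Q₁ : ℝ) (α : UnitAddCircle) (a : ℤ) (q : ℕ),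
        3 ≤ X → H₁ ≤ X → (Real.log X) ^ (20 * k * Real.log k) ≤ H₁ →
        Q₁ ≤ min (H₁ ^ (1 / 3 : ℝ) / (Real.log X) ^ (k * Real.log k))
          ((Real.log X) ^ (10000 * k ^ 10)) →
        1 ≤ q → (q : ℝ) ≤ Q₁ → IsCoprime a (q : ℤ) →
        ‖α - (((a : ℝ) / (q : ℝ) : ℝ) : UnitAddCircle)‖ < 1 / (q * Q₁) →
        ∃ E : Set ℝ, E ⊆ Set.Icc (X / 2) (2 * X) ∧ MeasurableSet E ∧
          volume E ≤
            ENNReal.ofReal (C * (X * (Real.log X) ^ (3 * k * Real.log k) / Q₁ ^ (1 / 8 : ℝ))) ∧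
          ∀ x ∈ Set.Icc (X / 2) (2 * X) \ E, ∀ H' ∈ Set.Icc 0 H₁,
            ‖∑ n ∈ Finset.Icc ⌈x⌉₊ ⌊x + H'⌋₊,
                (divisorTilde ε' k X n : ℂ) * fourier (n : ℤ) α‖ ≤
              C * ((1 / q + 1 / Q₁ ^ (1 / 8 : ℝ)) * H₁ * (Real.log X) ^ (k - 1 + δ X)) := by
  have hκ : 1 ≤ k - 1 := by linarith
  have hA0 : 0 ≤ 10000 * k ^ 10 := by positivity
  obtain ⟨C₁, X₁, hC₁, h₁⟩ := exists_sum_divisorFn_div_le hκ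
  obtain ⟨C₂, X₂, hC₂, h₂⟩ := exists_sum_inv_le
  obtain ⟨X₃, hX₃⟩ := eventually_atTop.1
    (eventually_rpow_log_mul_levelM_sq_le k (2 * (10000 * k ^ 10)))
  set X₀ := max (max X₁ X₂) (max X₃ 3)
  set A := 10000 * k ^ 10 with hA
  set W := Real.log X₀ ^ A
  set K := C₂ ^ 3 + 1
  have hX₀3 : 3 ≤ X₀ := (le_max_right _ _).trans (le_max_right _ _)
  have hW0 : 0 ≤ W := Real.rpow_nonneg (Real.log_nonneg (by linarith)) _
  have hK : 1 ≤ K := by simp only [K]; linarith [pow_pos hC₂ 3]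
  -- The summands serve, in order, the measure bound, the exponential sum bound, and the two trivial
  -- cases (`X` bounded, `Z ^ 3 < G`).
  set C := 720 * K + 48 * (C₁ + 1) + 2 * W + 2 with hC
  have hC0 : 0 < C := by positivity
  -- Chosen so that `(log X) ^ δ(X)` is exactly the maximum of `d_{k-1}` up to `(log X) ^ A`, a
  -- bound for `d_{k-1}(q)`.
  refine ⟨C, fun X => Real.log (divisorMax (k - 1) (Real.log X ^ A)) / Real.log (Real.log X), hC0,
    tendsto_log_divisorMax hκ hA0, ?_⟩
  intro X H Q α a q hX hHX hLH hQ hq hqQ hcop hα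
  have hX0 : 0 < X := by linarith
  have hL1 : 1 < Real.log X := by
    rw [Real.lt_log_iff_exp_lt hX0]
    exact Real.exp_one_lt_d9.trans_le (by linarith)
  have hL0 : 0 < Real.log X := by linarith
  have hLL : 0 < Real.log (Real.log X) := Real.log_pos hL1
  set L := Real.log X
  set G := L ^ (k * Real.log k) with hG
  set Z := Q ^ (1 / 8 : ℝ) with hZdef
  have hkk := one_le_mul_log hk
  have hLG : L ≤ G := by
    conv_lhs => rw [← Real.rpow_one L]
    exact Real.rpow_le_rpow_of_exponent_le hL1.le hkk
  have hG1 : 1 ≤ G := hL1.le.trans hLG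
  have hG3 : L ^ (3 * k * Real.log k) = G ^ 3 := by
    rw [hG, ← Real.rpow_natCast, ← Real.rpow_mul hL0.le]
    congr 1; push_cast; ring
  have hq1 : (1 : ℝ) ≤ q := by exact_mod_cast hq
  have hQ1 : 1 ≤ Q := hq1.trans hqQ
  have hZ1 : 1 ≤ Z := Real.one_le_rpow hQ1 (by norm_num)
  have hZ8 : Z ^ 8 = Q := by
    rw [hZdef, ← Real.rpow_natCast, ← Real.rpow_mul (by linarith)]
    norm_num
  have hH1 : 1 ≤ H := (Real.one_le_rpow hL1.le (by nlinarith)).trans hLH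
  have hZH : Z ^ 24 ≤ H := by
    have h : Q ≤ H ^ (1 / 3 : ℝ) :=
      (hQ.trans (min_le_left _ _)).trans (div_le_self (by positivity) hG1)
    calc Z ^ 24 = Q ^ 3 := by rw [← hZ8]; ring
      _ ≤ (H ^ (1 / 3 : ℝ)) ^ 3 := by gcongr
      _ = H := by
        rw [← Real.rpow_natCast, ← Real.rpow_mul (by linarith)]
        norm_num
  have hQA : Q ≤ L ^ A := hQ.trans (min_le_right _ _)
  rw [hG3]
  -- In these cases the claimed measure bound exceeds the length of `[X/2, 2X]`, so the whole
  -- interval can be exceptional.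
  by_cases htriv : X < X₀ ∨ Z ^ 3 < G
  · refine ⟨Set.Icc (X / 2) (2 * X), subset_rfl, measurableSet_Icc, ?_, by simp⟩
    rw [Real.volume_Icc]
    refine ENNReal.ofReal_le_ofReal ?_
    have hZC : 2 * Z ≤ C * G ^ 3 := by
      rcases htriv with h | h
      · have hZW : Z ≤ W := by
          calc Z ≤ Z ^ 8 := le_self_pow₀ hZ1 (by norm_num)
            _ = Q := hZ8
            _ ≤ L ^ A := hQA
            _ ≤ W := Real.rpow_le_rpow hL0.le (Real.log_le_log hX0 h.le) hA0
        calc 2 * Z ≤ C * 1 := by rw [hC]; linarith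
          _ ≤ C * G ^ 3 := by gcongr; exact one_le_pow₀ hG1
      · have h1 : Z ≤ G ^ 3 := by
          calc Z ≤ Z ^ 3 := le_self_pow₀ hZ1 (by norm_num)
            _ ≤ G := h.le
            _ ≤ G ^ 3 := le_self_pow₀ hG1 (by norm_num)
        have h2 : 2 ≤ C := by rw [hC]; linarith
        gcongr
    have h3 : 2 ≤ C * G ^ 3 / Z := by rwa [le_div_iff₀ (by linarith)]
    calc 2 * X - X / 2 ≤ X * 2 := by linarith
      _ ≤ X * (C * G ^ 3 / Z) := by gcongr
      _ = _ := by ring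
  · push Not at htriv
    obtain ⟨hXX₀, hGZ⟩ := htriv
    have hX₁ : X₁ ≤ X := ((le_max_left _ _).trans (le_max_left _ _)).trans hXX₀
    have hX₂ : X₂ ≤ X := ((le_max_right _ _).trans (le_max_left _ _)).trans hXX₀
    have hX₃' : X₃ ≤ X := ((le_max_left _ _).trans (le_max_right _ _)).trans hXX₀
    set M := levelM k X with hM
    have hlevel : L ^ (2 * A) * M ^ 2 ≤ X := hX₃ X hX₃'
    have hM1 : 1 ≤ M := Real.one_le_rpow (by linarith) (by positivity)
    have hL2A : 1 ≤ L ^ (2 * A) := Real.one_le_rpow hL1.le (by positivity)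
    have hNX : (⌊M⌋₊ : ℝ) ≤ X := by
      calc (⌊M⌋₊ : ℝ) ≤ M := Nat.floor_le (by linarith)
        _ ≤ 1 * M ^ 2 := by rw [one_mul]; exact le_self_pow₀ hM1 (by norm_num)
        _ ≤ L ^ (2 * A) * M ^ 2 := by gcongr
        _ ≤ X := hlevel
    set S := tildeModuli ε' k X
    have hSN : S ⊆ Finset.Icc 1 ⌊M⌋₊ := Finset.filter_subset _ _
    have hdS : ∀ m ∈ S, divisorFn (k - 1) m ≤ G ^ 2 := fun m hm =>
      divisorFn_le_of_mem_tildeModuli hk hε'_lt hLL.le hL0 hm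
    have hd0 : ∀ m, 0 ≤ divisorFn (k - 1) m := fun m =>
      zero_le_one.trans (one_le_divisorFn hκ m)
    have hLκ : 1 ≤ L ^ (k - 1) := Real.one_le_rpow hL1.le (by linarith)
    have hc : ∑ m ∈ Finset.Icc 1 ⌊M⌋₊, divisorFn (k - 1) m / m ≤ (C₁ + 1) * L ^ (k - 1) := by
      refine (h₁ X hX₁ _ hNX).trans ?_
      gcongr
      linarith
    have hc1 : 1 ≤ (C₁ + 1) * L ^ (k - 1) :=
      one_le_mul_of_one_le_of_one_le (by linarith) hLκ
    have hΛ : ∑ m₁ ∈ S, ∑ m₂ ∈ S, divisorFn (k - 1) m₁ * divisorFn (k - 1) m₂ *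
        ((m₁.lcm m₂ : ℕ) : ℝ)⁻¹ ≤ K * G ^ 7 := by
      refine (sum_mul_inv_lcm_le hSN (fun m _ => hd0 m) hdS).trans ?_
      have h3 : ∑ m ∈ Finset.Icc 1 ⌊M⌋₊, (m : ℝ)⁻¹ ≤ C₂ * G := (h₂ X hX₂ _ hNX).trans (by gcongr)
      -- Two weights of size `G ^ 2` and three harmonic sums of size `O(G)` make up `G ^ 7`.
      calc (G ^ 2) ^ 2 * (∑ m ∈ Finset.Icc 1 ⌊M⌋₊, (m : ℝ)⁻¹) ^ 3
          ≤ (G ^ 2) ^ 2 * (C₂ * G) ^ 3 := by gcongr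
        _ = C₂ ^ 3 * G ^ 7 := by ring
        _ ≤ _ := by
          gcongr
          simp only [K]
          linarith
    have hW : Z ^ 15 * (∑ m ∈ S, divisorFn (k - 1) m) ^ 2 ≤ X * G ^ 7 := by
      have h4 : ∑ m ∈ S, divisorFn (k - 1) m ≤ M * G ^ 2 := by
        calc ∑ m ∈ S, divisorFn (k - 1) m ≤ ∑ _m ∈ S, G ^ 2 := Finset.sum_le_sum hdS
          _ = S.card * G ^ 2 := by simp
          _ ≤ ⌊M⌋₊ * G ^ 2 := by
            gcongr
            simpa using Finset.card_le_card hSN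
          _ ≤ M * G ^ 2 := by
            gcongr
            exact Nat.floor_le (by linarith)
      have h5 : Z ^ 15 ≤ L ^ (2 * A) := by
        calc Z ^ 15 ≤ Z ^ 16 := pow_le_pow_right₀ hZ1 (by norm_num)
          _ = Q ^ 2 := by rw [← hZ8]; ring
          _ ≤ (L ^ A) ^ 2 := by gcongr
          _ = L ^ (2 * A) := by
            rw [← Real.rpow_natCast, ← Real.rpow_mul hL0.le, mul_comm]
            norm_num
      calc Z ^ 15 * (∑ m ∈ S, divisorFn (k - 1) m) ^ 2
          ≤ L ^ (2 * A) * (M * G ^ 2) ^ 2 := by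
            have := Finset.sum_nonneg fun m (_ : m ∈ S) => hd0 m
            gcongr
        _ = L ^ (2 * A) * M ^ 2 * G ^ 4 := by ring
        _ ≤ X * G ^ 4 := by gcongr
        _ ≤ X * G ^ 7 := by
          gcongr
          norm_num
    obtain ⟨β, hαβ, hβ⟩ := exists_eq_add_coe_of_norm_sub_lt hα
    set D := divisorMax (k - 1) (L ^ A) with hDdef
    have hD1 : 1 ≤ D := one_le_divisorMax _ _
    obtain ⟨E, hE1, hE2, hE3, hE4⟩ := exists_exceptional_set hSN hκ hX hHX hK hG1 hGZ hZ1 hZH hc hc1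
      hΛ hW hq (by rwa [hZ8]) (exp_two_pi_mul_I_div_mul_pow_eq_one_iff hq hcop)
      (by rw [hZ8]; exact hβ.le) (divisorFn_le_divisorMax (k - 1) hq (hqQ.trans hQA))
    refine ⟨E, hE1, hE2, hE3.trans (ENNReal.ofReal_le_ofReal ?_), ?_⟩
    · gcongr
      rw [hC]
      linarith
    · intro x hx H' hH'
      have hx0 : 0 ≤ x := by linarith [hx.1.1]
      have hb := norm_sum_Icc_cutoff_le (fun n => (divisorSum S (divisorFn (k - 1)) n : ℂ) *
        Complex.exp (2 * Real.pi * Complex.I / q * a) ^ n *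
        Complex.exp (2 * Real.pi * Complex.I * β * (n : ℕ))) hX0.le hx0 hH'.1
        (fun h hh => hE4 x hx h (by linarith [hH'.2]))
      have e : ∀ n ∈ Finset.Icc ⌈x⌉₊ ⌊x + H'⌋₊,
          (divisorTilde ε' k X n : ℂ) * fourier (n : ℤ) α = if X < n ∧ (n : ℝ) ≤ 2 * X then
            (divisorSum S (divisorFn (k - 1)) n : ℂ) *
              Complex.exp (2 * Real.pi * Complex.I / q * a) ^ n *
              Complex.exp (2 * Real.pi * Complex.I * β * (n : ℕ)) else 0 := by
        intro n _
        rw [divisorTilde_eq ε' k X hX0.le, hαβ, fourier_natCast_div_add]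
        split_ifs
        · ring
        · simp
      rw [Finset.sum_congr rfl e]
      refine hb.trans ?_
      have hLδ : L ^ (k - 1 + Real.log D / Real.log L) = L ^ (k - 1) * D := by
        rw [Real.rpow_add hL0, Real.rpow_def_of_pos hL0 (Real.log D / Real.log L),
          mul_div_cancel₀ _ hLL.ne', Real.exp_log (by linarith)]
      rw [hLδ]
      calc 2 * (24 * ((1 / q + 1 / Z) * H * ((C₁ + 1) * L ^ (k - 1) * D)))
          = 48 * (C₁ + 1) * ((1 / q + 1 / Z) * H * (L ^ (k - 1) * D)) := by ring
        _ ≤ C * ((1 / q + 1 / Z) * H * (L ^ (k - 1) * D)) := by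
          gcongr
          rw [hC]
          linarith
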